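/- Let $G$ be an undirected graph on $n$ vertices in which every edge is present independently with probability $p = 2(\log n)/n$ (natural logarithm). Let $V=\{x_1,\dots,x_n\}$ be any ordering of the vertices, fixed independently of $G$. Run the following pruned labeling algorithm of Akiba et al. on $G$, viewed as a directed graph with both orientations of every edge. Every vertex $u$ has two landmark sets $L_F(u)$ and $L_B(u)$, initially empty, whose keys are vertices and whose values are distances. For $i=1,\dots,n$, perform first a forward and then a backward search from $x_i$. In the forward search, a priority queue initially contains only $x_i$, with priority $0$. While the queue is nonempty, extract from it a vertex $u$ of minimum priority $l$ (ties are broken arbitrarily), and let $\tilde d$ be the minimum, over the common keys $y$ of $L_F(x_i)$ and $L_B(u)$, of the sum of the two values stored for $y$ ($\tilde d=\infty$ if there is no common key). If $l<\tilde d$, add the key $x_i$ with value $l$ to $L_B(u)$, and for every out-neighbour $y$ of $u$ with $y\notin\{x_1,\dots,x_{i-1}\}$ that has not yet been extracted, lower the priority of $y$ to $l+1$ if it is larger than $l+1$ (vertices that were never enqueued have priority $\infty$). If $l\ge\tilde d$, the search is not continued from $u$. The backward search is the same with in-neighbours in place of out-neighbours and the roles of $L_F$ and $L_B$ exchanged.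 Then the total number of landmarks $\sum_{u\in V}\bigl(|L_F(u)|+|L_B(u)|\bigr)$ is $\tilde\Omega(n^2)$ with high probability. That is, there are absolute constants $c>0$ and $k\in\mathbb N$ such that, for every choice of one ordering of the $n$ vertices for each $n$, the probability over $G$ that, for every way of breaking ties, $$\sum_{u\in V}\bigl(|L_F(u)|+|L_B(u)|\bigr)\;\ge\;\frac{c\,n^2}{(\log n)^k}$$ tends to $1$ as $n\to\infty$. -/

import Mathlib

open Filter Topology

namespace PrunedLabeling

/-- State of one pruned breadth-first search: the priority of every vertex (`⊤` if it was never
enqueued), the set `S` of vertices already extracted from the queue, and the landmark table being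
filled. A table `L : V → V → ℕ∞` is a family of finite maps: `L u y` is the value stored for the
key `y` in the landmark set of `u`, and `L u y = ⊤` means that `y` is not a key. -/
@[ext]
structure BFSState (V : Type*) where
  prio : V → ℕ∞
  done : Finset V
  table : V → V → ℕ∞

namespace BFSState

variable {V : Type*} [Fintype V]

open Classical in
/-- The vertices waiting in the priority queue. -/
noncomputable def queue (s : BFSState V) : Finset V :=
  Finset.univ.filter fun v => s.prio v ≠ ⊤ ∧ v ∉ s.done

open Classical in
/-- The vertices of minimum priority in the queue. -/
noncomputable def front (s : BFSState V) : Finset V :=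
  s.queue.filter fun v => ∀ w ∈ s.queue, s.prio v ≤ s.prio w

end BFSState

variable {V : Type*} [Fintype V]

/-- `pick` is a tie-breaking rule: from every state whose queue is not empty it extracts a vertex
of minimum priority. -/
def IsExtractMin (pick : BFSState V → V) : Prop :=
  ∀ s : BFSState V, s.queue.Nonempty → pick s ∈ s.front

/-- The estimate obtained from two landmark sets: the minimum, over their common keys, of the sum
of the two stored values (`⊤` if there is no common key). -/
noncomputable def estimate (L₁ L₂ : V → ℕ∞) : ℕ∞ := ⨅ y, L₁ y + L₂ y

open Classical in
/-- One pass through the while loop of the pruned search from `x`. Here `N u y` says that `y` is a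
neighbour of `u` in the direction of the search, `O` is the set of roots already treated, and `own`
is the landmark set of `x` that is consulted for pruning. -/
noncomputable def bfsStep (pick : BFSState V → V) (N : V → V → Prop) (O : Finset V) (x : V)
    (own : V → ℕ∞) (s : BFSState V) : BFSState V :=
  if s.queue.Nonempty then
    let u := pick s
    let l := s.prio u
    let S := insert u s.done
    if l < estimate own (s.table u) then
      { prio := fun y => if N u y ∧ y ∉ O ∧ y ∉ S ∧ l + 1 < s.prio y then l + 1 else s.prio y
        done := S
        table := Function.update s.table u (Function.update (s.table u) x l) }
    else { s with done := S }
  else s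

open Classical in
/-- The state before the search from `x`: only `x` is enqueued, with priority `0`. -/
noncomputable def bfsInit (x : V) (L : V → V → ℕ∞) : BFSState V where
  prio := Function.update (fun _ => ⊤) x 0
  done := ∅
  table := L

/-- The table resulting from the pruned search from `x`. Every pass through the loop extracts a new
vertex, so that after `|V|` passes the queue is empty (see `queue_bfs_eq_empty`). -/
noncomputable def bfs (pick : BFSState V → V) (N : V → V → Prop) (O : Finset V) (x : V)
    (own : V → ℕ∞) (L : V → V → ℕ∞) : V → V → ℕ∞ :=
  ((bfsStep pick N O x own)^[Fintype.card V] (bfsInit x L)).table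

theorem queue_bfs_eq_empty {pick : BFSState V → V} (hpick : IsExtractMin pick)
    (N : V → V → Prop) (O : Finset V) (x : V) (own : V → ℕ∞) (L : V → V → ℕ∞) :
    ((bfsStep pick N O x own)^[Fintype.card V] (bfsInit x L)).queue = ∅ := by
  classical
  have key : ∀ k : ℕ, ((bfsStep pick N O x own)^[k] (bfsInit x L)).queue = ∅ ∨
      k ≤ ((bfsStep pick N O x own)^[k] (bfsInit x L)).done.card := by
    intro k
    induction k with
    | zero => right; simp
    | succ k ih =>
      rw [Function.iterate_succ_apply']
      set s := (bfsStep pick N O x own)^[k] (bfsInit x L)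
      by_cases hq : s.queue.Nonempty
      · right
        have hk : k ≤ s.done.card := ih.resolve_left hq.ne_empty
        have hu : pick s ∉ s.done := by
          have h := hpick s hq
          simp only [BFSState.front, BFSState.queue, Finset.mem_filter] at h
          exact h.1.2.2
        have hd : (bfsStep pick N O x own s).done = insert (pick s) s.done := by
          unfold bfsStep
          rw [if_pos hq]
          dsimp only
          split_ifs
          · simp
          · simp
        rw [hd, Finset.card_insert_of_notMem hu]
        lia
      · left
        have : bfsStep pick N O x own s = s := by
          unfold bfsStep
          rw [if_neg hq]
        rw [this]
        exact Finset.not_nonempty_iff_eq_empty.mp hq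
  rcases key (Fintype.card V) with h | h
  · exact h
  · have hu := Finset.eq_univ_of_card _ (le_antisymm (Finset.card_le_univ _) h)
    simp [BFSState.queue, hu]

/-- State of the main loop: the set `O` of treated roots and the tables `L_F`, `L_B` of forward and
backward landmarks. -/
@[ext]
structure Labels (V : Type*) where
  treated : Finset V
  fwd : V → V → ℕ∞
  bwd : V → V → ℕ∞

open Classical in
/-- One round of the main loop: the forward search from `x` along out-neighbours, which adds `x` to
backward landmark sets, then the backward search along in-neighbours, which adds `x` to forward
landmark sets. -/
noncomputable def round (pick : BFSState V → V) (G : Digraph V) (s : Labels V) (x : V) :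
    Labels V :=
  let B := bfs pick G.Adj s.treated x (s.fwd x) s.bwd
  let F := bfs pick (fun u y => G.Adj y u) s.treated x (B x) s.fwd
  { treated := insert x s.treated, fwd := F, bwd := B }

/-- The pruned labeling algorithm on the directed graph `G` with the given ordering of the
vertices. -/
noncomputable def prunedLabeling (pick : BFSState V → V) (G : Digraph V) (order : List V) :
    Labels V :=
  order.foldl (round pick G) { treated := ∅, fwd := fun _ _ => ⊤, bwd := fun _ _ => ⊤ }

open Classical in
/-- The total number of landmarks, `∑ u, (|L_F(u)| + |L_B(u)|)`. -/
noncomputable def Labels.total (s : Labels V) : ℕ :=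
  ∑ u : V, ((Finset.univ.filter fun y => s.fwd u y ≠ ⊤).card +
    (Finset.univ.filter fun y => s.bwd u y ≠ ⊤).card)

/-- An undirected graph as a directed graph, each edge being present in both directions. -/
def toDigraph {V : Type*} (G : SimpleGraph V) : Digraph V := ⟨G.Adj⟩

/-- The edge probability `2 log n / n`; it lies in `[0, 1]` for every `n` (for `n = 0` it is
`0`). -/
noncomputable def edgeProb (n : ℕ) : unitInterval :=
  ⟨2 * Real.log n / n, by
    rcases Nat.eq_zero_or_pos n with rfl | hn
    · simp
    · have h1 : (1 : ℝ) ≤ n := by exact_mod_cast hn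
      have h0 : (0 : ℝ) < n := by linarith
      refine ⟨div_nonneg (mul_nonneg (by norm_num) (Real.log_nonneg h1)) h0.le, ?_⟩
      rw [div_le_one h0]
      have hs : 0 < Real.sqrt n := Real.sqrt_pos.mpr h0
      have hsq : Real.sqrt n ^ 2 = n := Real.sq_sqrt h0.le
      have hl : Real.log n = 2 * Real.log (Real.sqrt n) := by
        rw [Real.log_sqrt h0.le]; ring
      have := Real.log_le_sub_one_of_pos hs
      nlinarith [sq_nonneg (Real.sqrt n - 2)]⟩

end PrunedLabeling

namespace PrunedLabeling

/-! Write l = log n, so that the mean degree is about 2l. Only the set X of the first m ≈ n/l^8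
roots and their backward landmarks are counted. A root x labels v whenever no earlier root lies on a
shortest path from x to v: the search then reaches v at its true distance and no pruning test on the
way can fail (`bfs_ne_top_of_unblocked`, `prunedLabeling_bwd_ne_top`).

Let L be maximal with (2l)^L ≤ n. Two estimates show that most pairs at distance at most L with
first vertex in X are of this kind. The ball of radius L around a vertex has at least T = n/l^3
vertices with high probability (`graphProb_closedBall_lt_le`), so X sees about mT pairs. A pair
spoiled by another vertex of X yields a path of length at most L with two vertices in X, and the
expected number of these is at most (L+1)^2 m^2 (2l)^L/n ≤ (L+1)^2 m^2
(`graphExp_card_blockedPairs_le`). This is much less than mT, because m is smaller than T by the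
factor l^5 and L ≤ l. Markov's inequality leaves at least mT/4 landmarks, of order n^2/l^11, for any
fixed order and simultaneously for all tie-breaking rules: both exceptional events concern only the
graph and X. -/

theorem ofFn_eq_append_cons {V : Type*} {n : ℕ} (f : Fin n → V) (i : Fin n) :
    List.ofFn f = (List.ofFn f).take i ++ f i :: (List.ofFn f).drop (i + 1) := by
  have h : (i : ℕ) < (List.ofFn f).length := by simp
  conv_lhs => rw [← List.take_append_drop i (List.ofFn f), List.drop_eq_getElem_cons h]
  simp

/-! ### Shortest paths that avoid earlier roots -/

section Unblocked

variable {V : Type*} {G : SimpleGraph V} {O : Finset V} {x : V}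

/-- No shortest path from `x` to `v` meets `O`. -/
def Unblocked (G : SimpleGraph V) (O : Finset V) (x v : V) : Prop :=
  G.edist x v ≠ ⊤ ∧ ∀ y ∈ O, G.edist x v < G.edist x y + G.edist y v

/-- A vertex of `O` on a shortest path to the predecessor would also lie on a shortest path to `v`,
through the last edge. Hence being unblocked is inherited backwards along a geodesic, which allows
induction on the distance. -/
theorem Unblocked.exists_pred {v : V} (h : Unblocked G O x v) (hv : v ≠ x) :
    ∃ w, Unblocked G O x w ∧ G.Adj w v ∧ G.edist x v = G.edist x w + 1 := by
  obtain ⟨q, hq⟩ := SimpleGraph.exists_walk_of_edist_ne_top h.1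
  have hnil : ¬ q.Nil := SimpleGraph.Walk.not_nil_of_ne hv.symm
  have hadj := q.adj_penultimate hnil
  have hlen : q.dropLast.length + 1 = q.length := by
    have := q.length_dropLast_add_one hnil
    simpa using this
  have hle : G.edist x q.penultimate + 1 ≤ G.edist x v := by
    rw [← hq, ← hlen, Nat.cast_add, Nat.cast_one]
    gcongr
    exact q.dropLast.edist_le
  have hge : G.edist x v ≤ G.edist x q.penultimate + 1 := by
    refine (SimpleGraph.edist_triangle (v := q.penultimate)).trans ?_
    rw [SimpleGraph.edist_eq_one_iff_adj.mpr hadj]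
  have heq := le_antisymm hge hle
  refine ⟨q.penultimate, ⟨fun ht => h.1 (by rw [heq, ht]; rfl), fun y hy => ?_⟩, hadj, heq⟩
  by_contra hcon
  push Not at hcon
  refine absurd (h.2 y hy) (not_lt.mpr ?_)
  calc G.edist x y + G.edist y v
      ≤ G.edist x y + (G.edist y q.penultimate + G.edist q.penultimate v) := by
        gcongr; exact SimpleGraph.edist_triangle
    _ = (G.edist x y + G.edist y q.penultimate) + 1 := by
        rw [SimpleGraph.edist_eq_one_iff_adj.mpr hadj, add_assoc]
    _ ≤ G.edist x v := by rw [heq]; gcongr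

end Unblocked

/-! ### One pruned search: soundness and completeness on unblocked vertices -/

section Search

variable {V : Type*} [Fintype V] {G : SimpleGraph V} {pick : BFSState V → V}
  {N : V → V → Prop} {O : Finset V} {x : V} {own : V → ℕ∞} {L : V → V → ℕ∞}

/-- A search from `x` writes true upper bounds for distances under the key `x` and changes no other
key. -/
theorem sound_iterate_bfsStep (hN : ∀ u y, N u y → G.Adj u y)
    (hL : ∀ u, G.edist x u ≤ L u x) (k : ℕ) (v : V) :
    G.edist x v ≤ ((bfsStep pick N O x own)^[k] (bfsInit x L)).prio v ∧
    G.edist x v ≤ ((bfsStep pick N O x own)^[k] (bfsInit x L)).table v x ∧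
    ∀ y, y ≠ x → ((bfsStep pick N O x own)^[k] (bfsInit x L)).table v y = L v y := by
  classical
  induction k generalizing v with
  | zero =>
    refine ⟨?_, hL v, fun _ _ => rfl⟩
    rcases eq_or_ne v x with rfl | h
    · simp
    · simp [bfsInit, Function.update_of_ne h]
  | succ k ih =>
    rw [Function.iterate_succ_apply']
    set s := (bfsStep pick N O x own)^[k] (bfsInit x L)
    unfold bfsStep
    by_cases hq : s.queue.Nonempty
    · rw [if_pos hq]
      dsimp only
      by_cases hl : s.prio (pick s) < estimate own (s.table (pick s))
      · rw [if_pos hl]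
        refine ⟨?_, ?_, ?_⟩
        · dsimp only
          split_ifs with h
          · calc G.edist x v ≤ G.edist x (pick s) + G.edist (pick s) v := SimpleGraph.edist_triangle
              _ ≤ _ := add_le_add (ih _).1
                (SimpleGraph.edist_eq_one_iff_adj.mpr (hN _ _ h.1)).le
          · exact (ih v).1
        · dsimp only
          rcases eq_or_ne v (pick s) with h | h
          · rw [h]; simpa using (ih _).1
          · rw [Function.update_of_ne h]; exact (ih v).2.1
        · intro y hy
          dsimp only
          rcases eq_or_ne v (pick s) with h | h
          · rw [h, Function.update_self, Function.update_of_ne hy]; exact (ih _).2.2 y hy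
          · rw [Function.update_of_ne h]; exact (ih v).2.2 y hy
      · rw [if_neg hl]
        exact ih v
    · rw [if_neg hq]
      exact ih v

/-- The progress made by a search from `x` in direction of `G`. -/
structure Progress (G : SimpleGraph V) (O : Finset V) (x : V) (s : BFSState V) : Prop where
  root : s.prio x = 0
  labeled : ∀ v ∈ s.done, Unblocked G O x v → s.table v x ≠ ⊤ ∧ s.prio v ≤ G.edist x v
  reached : ∀ v ∈ s.done, Unblocked G O x v → ∀ w, Unblocked G O x w → G.Adj v w →
    G.edist x w = G.edist x v + 1 → s.prio w ≤ G.edist x w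

/-- Going back along a geodesic, one meets either an extracted predecessor, whose successor was then
enqueued in time, or the root itself. So an unblocked vertex is never extracted late, and the queue
cannot run empty before it is extracted. -/
theorem Progress.exists_mem_queue {s : BFSState V} (hs : Progress G O x s) (d : ℕ) :
    ∀ v, G.edist x v = d → Unblocked G O x v → v ∉ s.done →
      ∃ z ∈ s.queue, s.prio z ≤ G.edist x v := by
  classical
  induction d with
  | zero =>
    intro v hd hv hdone
    have hxv : x = v := by simpa using hd
    subst hxv
    exact ⟨x, by simp [BFSState.queue, hs.root, hdone], by simp [hs.root]⟩
  | succ d ih =>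
    intro v hd hv hdone
    have hne : v ≠ x := by 
      rintro rfl
      simp at hd
      exact absurd hd.symm (by exact_mod_cast d.succ_ne_zero)
    obtain ⟨w, hw, hadj, heq⟩ := hv.exists_pred hne
    by_cases hwd : w ∈ s.done
    · have h := hs.reached w hwd hw v hv hadj heq
      refine ⟨v, ?_, h⟩
      simp only [BFSState.queue, Finset.mem_filter, Finset.mem_univ, true_and]
      exact ⟨ne_top_of_le_ne_top hv.1 h, hdone⟩
    · have hwdist : G.edist x w = d := by
        rw [heq] at hd
        push_cast at hd
        exact ENat.add_left_injective_of_ne_top ENat.one_ne_top hd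
      obtain ⟨z, hz, hzl⟩ := ih w hwdist hw hwd
      exact ⟨z, hz, hzl.trans (by rw [heq]; exact le_self_add)⟩

theorem progress_iterate_bfsStep (hpick : IsExtractMin pick) (hx : x ∉ O)
    (hN : ∀ u y, N u y ↔ G.Adj u y) (hL : ∀ u y, G.edist y u ≤ L u y)
    (hown : ∀ y, G.edist x y ≤ own y) (hkey : ∀ y, own y ≠ ⊤ → y ∈ O) (k : ℕ) :
    Progress G O x ((bfsStep pick N O x own)^[k] (bfsInit x L)) := by
  classical
  induction k with
  | zero =>
    exact ⟨by simp [bfsInit], by simp [bfsInit], by simp [bfsInit]⟩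
  | succ k ih =>
    have hsound := sound_iterate_bfsStep (pick := pick) (O := O) (own := own)
      (fun u y => (hN u y).mp) (fun u => hL u x) k
    rw [Function.iterate_succ_apply']
    set s := (bfsStep pick N O x own)^[k] (bfsInit x L)
    by_cases hq : s.queue.Nonempty
    swap
    · rwa [bfsStep, if_neg hq]
    have hfront := hpick s hq
    simp only [BFSState.front, BFSState.queue, Finset.mem_filter, Finset.mem_univ,
      true_and] at hfront
    -- Minimality of the extracted priority against the queued vertex from `exists_mem_queue` gives
    -- the upper bound; soundness gives the lower one.
    have hprio : Unblocked G O x (pick s) → s.prio (pick s) = G.edist x (pick s) := by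
      intro hg
      refine le_antisymm ?_ (hsound _).1
      obtain ⟨d, hd⟩ := ENat.ne_top_iff_exists.mp hg.1
      obtain ⟨z, hz, hzl⟩ := ih.exists_mem_queue d (pick s) hd.symm hg hfront.1.2
      refine (hfront.2 z ?_).trans hzl
      simpa [BFSState.queue] using hz
    -- Unblocked vertices are never pruned: common keys lie in `O`, stored values dominate
    -- distances, and every detour through `O` is strictly longer.
    have hest : Unblocked G O x (pick s) →
        s.prio (pick s) < estimate own (s.table (pick s)) := by
      intro hg
      -- A strict bound need not pass to an infimum, so it is rewritten as a weak bound with `+ 1`.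
      rw [hprio hg, ← ENat.add_one_le_iff hg.1, estimate]
      refine le_iInf fun y => ?_
      rw [ENat.add_one_le_iff hg.1]
      by_cases hy : own y = ⊤
      · rw [hy, top_add]; exact lt_top_iff_ne_top.mpr hg.1
      · have hyO := hkey y hy
        refine (hg.2 y hyO).trans_le (add_le_add (hown y) ?_)
        rw [(hsound _).2.2 y (by rintro rfl; exact hx hyO)]
        exact hL _ _
    unfold bfsStep
    rw [if_pos hq]
    dsimp only
    by_cases hl : s.prio (pick s) < estimate own (s.table (pick s))
    · rw [if_pos hl]
      have hmono : ∀ y, (if N (pick s) y ∧ y ∉ O ∧ y ∉ insert (pick s) s.done ∧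
          s.prio (pick s) + 1 < s.prio y then s.prio (pick s) + 1 else s.prio y) ≤ s.prio y := by
        intro y
        split_ifs with h
        · exact h.2.2.2.le
        · exact le_rfl
      refine ⟨?_, ?_, ?_⟩
      · exact le_antisymm ((hmono x).trans ih.root.le) (zero_le)
      · intro v hv hg
        rcases Finset.mem_insert.mp hv with rfl | hv
        · refine ⟨?_, (hmono _).trans (hprio hg).le⟩
          simp only [Function.update_self]
          rw [hprio hg]
          exact hg.1
        · refine ⟨?_, (hmono _).trans (ih.labeled v hv hg).2⟩
          have hne : v ≠ pick s := by rintro rfl; exact hfront.1.2 hv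
          simp only [Function.update_of_ne hne]
          exact (ih.labeled v hv hg).1
      · intro v hv hg w hgw hadj hd
        rcases Finset.mem_insert.mp hv with rfl | hv
        · by_cases hw : w ∈ s.done
          · exact (hmono w).trans (ih.labeled w hw hgw).2
          -- Taking `w` itself as the intermediate vertex shows that an unblocked vertex is not in
          -- `O`.
          · have hwO : w ∉ O := fun h => by simpa using hgw.2 w h
            have hwp : w ∉ insert (pick s) s.done := by
              rw [Finset.mem_insert, not_or]
              exact ⟨hadj.ne', hw⟩
            dsimp only
            split_ifs with h
            · rw [hprio hg, hd]
            · rw [hd, ← hprio hg]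
              by_contra hcon
              exact h ⟨(hN _ _).mpr hadj, hwO, hwp, not_le.mp hcon⟩
        · exact (hmono w).trans (ih.reached v hv hg w hgw hadj hd)
    · rw [if_neg hl]
      refine ⟨ih.root, ?_, ?_⟩
      · intro v hv hg
        rcases Finset.mem_insert.mp hv with rfl | hv
        · exact absurd (hest hg) hl
        · exact ih.labeled v hv hg
      · intro v hv hg
        rcases Finset.mem_insert.mp hv with rfl | hv
        · exact absurd (hest hg) hl
        · exact ih.reached v hv hg

theorem bfs_apply_of_ne (hN : ∀ u y, N u y → G.Adj u y) (hL : ∀ u, G.edist x u ≤ L u x)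
    {y : V} (hy : y ≠ x) (v : V) : bfs pick N O x own L v y = L v y :=
  (sound_iterate_bfsStep hN hL _ v).2.2 y hy

theorem edist_le_bfs (hN : ∀ u y, N u y → G.Adj u y) (hL : ∀ u y, G.edist y u ≤ L u y) (v y : V) :
    G.edist y v ≤ bfs pick N O x own L v y := by
  rcases eq_or_ne y x with rfl | hy
  · exact (sound_iterate_bfsStep hN (fun u => hL u _) _ v).2.1
  · rw [bfs_apply_of_ne hN (fun u => hL u x) hy]
    exact hL v y

theorem bfs_ne_top_of_unblocked (hpick : IsExtractMin pick) (hx : x ∉ O)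
    (hN : ∀ u y, N u y ↔ G.Adj u y) (hL : ∀ u y, G.edist y u ≤ L u y)
    (hown : ∀ y, G.edist x y ≤ own y) (hkey : ∀ y, own y ≠ ⊤ → y ∈ O) {v : V}
    (hv : Unblocked G O x v) : bfs pick N O x own L v x ≠ ⊤ := by
  have hP := progress_iterate_bfsStep hpick hx hN hL hown hkey (Fintype.card V)
  refine (hP.labeled v ?_ hv).1
  by_contra hdone
  obtain ⟨d, hd⟩ := ENat.ne_top_iff_exists.mp hv.1
  obtain ⟨z, hz, -⟩ := hP.exists_mem_queue d v hd.symm hv hdone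
  rw [queue_bfs_eq_empty hpick] at hz
  simp at hz

end Search

/-! ### The main loop -/

section Labels

variable {V : Type*} [Fintype V] {G : SimpleGraph V} {pick : BFSState V → V}

/-- All stored values are upper bounds for distances, and all keys are treated roots. -/
structure Labels.Valid (G : SimpleGraph V) (s : Labels V) : Prop where
  fwd_le : ∀ u y, G.edist y u ≤ s.fwd u y
  bwd_le : ∀ u y, G.edist y u ≤ s.bwd u y
  fwd_key : ∀ u y, s.fwd u y ≠ ⊤ → y ∈ s.treated

theorem Labels.Valid.round {s : Labels V} (hs : s.Valid G) (x : V) :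
    (round pick (toDigraph G) s x).Valid G := by
  classical
  have hN : ∀ u y, (toDigraph G).Adj y u → G.Adj u y := fun u y h => G.adj_symm h
  refine ⟨fun u y => edist_le_bfs hN hs.fwd_le u y,
    fun u y => edist_le_bfs (fun _ _ h => h) hs.bwd_le u y, fun u y h => ?_⟩
  rcases eq_or_ne y x with rfl | hy
  · simp [PrunedLabeling.round]
  · refine Finset.mem_insert_of_mem (hs.fwd_key u y ?_)
    rw [← bfs_apply_of_ne hN (fun u => hs.fwd_le u x) hy u]
    exact h

theorem Labels.Valid.round_bwd_of_ne {s : Labels V} (hs : s.Valid G) {x y : V} (hy : y ≠ x)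
    (u : V) : (PrunedLabeling.round pick (toDigraph G) s x).bwd u y = s.bwd u y :=
  bfs_apply_of_ne (G := G) (fun _ _ h => h) (fun u => hs.bwd_le u x) hy u

theorem Labels.Valid.foldl {l : List V} : ∀ {s : Labels V}, s.Valid G →
    (l.foldl (PrunedLabeling.round pick (toDigraph G)) s).Valid G := by
  induction l with
  | nil => intro s hs; exact hs
  | cons x l ih => intro s hs; exact ih (hs.round x)

/-- A key is written only in the round of its own root, so landmarks gained there survive to the
end. -/
theorem Labels.Valid.foldl_bwd_of_notMem {y : V} {l : List V} : ∀ {s : Labels V}, s.Valid G →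
    y ∉ l → ∀ u, (l.foldl (PrunedLabeling.round pick (toDigraph G)) s).bwd u y = s.bwd u y := by
  induction l with
  | nil => intro s _ _ u; rfl
  | cons x l ih =>
    intro s hs hy u
    rw [List.mem_cons, not_or] at hy
    rw [List.foldl_cons, ih (hs.round x) hy.2, hs.round_bwd_of_ne hy.1]

theorem treated_foldl [DecidableEq V] (D : Digraph V) (l : List V) : ∀ s : Labels V,
    (l.foldl (round pick D) s).treated = s.treated ∪ l.toFinset := by
  induction l with
  | nil => intro s; simp
  | cons x l ih =>
    intro s
    rw [List.foldl_cons, ih]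
    ext y
    simp [round, or_assoc]

/-- A root `x` labels every vertex `v` such that no earlier root lies on a shortest path from `x`
to `v`. -/
theorem prunedLabeling_bwd_ne_top [DecidableEq V] (hpick : IsExtractMin pick) {l₁ l₂ : List V}
    {x : V} (h₁ : x ∉ l₁) (h₂ : x ∉ l₂) {v : V} (hv : Unblocked G l₁.toFinset x v) :
    (prunedLabeling pick (toDigraph G) (l₁ ++ x :: l₂)).bwd v x ≠ ⊤ := by
  have h0 : Labels.Valid G
      { treated := ∅, fwd := fun _ _ => ⊤, bwd := fun _ _ => ⊤ } :=
    ⟨fun _ _ => le_top, fun _ _ => le_top, fun _ _ h => absurd rfl h⟩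
  have hs := h0.foldl (pick := pick) (l := l₁)
  rw [prunedLabeling, List.foldl_append, List.foldl_cons,
    (hs.round x).foldl_bwd_of_notMem h₂]
  have ht := treated_foldl (pick := pick) (toDigraph G) l₁
    { treated := ∅, fwd := fun _ _ => ⊤, bwd := fun _ _ => ⊤ }
  rw [Finset.empty_union] at ht
  refine bfs_ne_top_of_unblocked (G := G) hpick ?_ (fun _ _ => Iff.rfl) hs.bwd_le
    (fun y => ?_) (fun y => hs.fwd_key x y) ?_
  · rw [ht]; simpa using h₁
  · rw [SimpleGraph.edist_comm]; exact hs.fwd_le x y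
  · rw [ht]; exact hv

theorem prunedLabeling_ofFn_bwd_ne_top [DecidableEq V] (hpick : IsExtractMin pick) {n : ℕ}
    {f : Fin n → V} (hf : f.Injective) (i : Fin n) {v : V}
    (hv : Unblocked G ((Finset.univ.filter fun j => j < i).image f) (f i) v) :
    (prunedLabeling pick (toDigraph G) (List.ofFn f)).bwd v (f i) ≠ ⊤ := by
  have hnd : (List.ofFn f).Nodup := List.nodup_ofFn.mpr hf
  rw [ofFn_eq_append_cons f i] at hnd ⊢
  have htake : ((List.ofFn f).take i).toFinset = (Finset.univ.filter fun j => j < i).image f := by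
    ext y
    simp only [List.mem_toFinset, List.mem_take_iff_getElem, List.getElem_ofFn, Finset.mem_image,
      Finset.mem_filter, Finset.mem_univ, true_and, List.length_ofFn]
    constructor
    · rintro ⟨j, hj, rfl⟩
      have := lt_min_iff.mp hj
      exact ⟨⟨j, this.2⟩, this.1, rfl⟩
    · rintro ⟨j, hj, rfl⟩
      exact ⟨j, lt_min hj j.2, rfl⟩
  have hn := List.nodup_append.mp hnd
  refine prunedLabeling_bwd_ne_top hpick ?_ ?_ (htake ▸ hv)
  · intro h
    exact hn.2.2 _ h _ List.mem_cons_self rfl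
  · exact (List.nodup_cons.mp hn.2.1).1

open Classical in
theorem card_le_total {s : Labels V} {D : Finset (V × V)}
    (h : ∀ q ∈ D, s.bwd q.2 q.1 ≠ ⊤) : D.card ≤ s.total := by
  calc D.card ≤ (Finset.univ.filter fun q : V × V => s.bwd q.2 q.1 ≠ ⊤).card :=
        Finset.card_le_card fun q hq => by simpa using h q hq
    _ = ∑ u : V, (Finset.univ.filter fun y => s.bwd u y ≠ ⊤).card := by
        simp only [Finset.card_filter]
        rw [← Finset.univ_product_univ, Finset.sum_product_right]
    _ ≤ s.total := Finset.sum_le_sum fun u _ => Nat.le_add_left _ _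

end Labels

/-! ### Deterministic lower bound for the number of landmarks -/

section Counting

open Classical in
/-- The pairs of a vertex of `X` and a vertex outside `X` at distance at most `ℓ` with another
vertex of `X` on a shortest path between them. -/
noncomputable def blockedPairs {V : Type*} [Fintype V] (G : SimpleGraph V) (X : Finset V) (ℓ : ℕ) :
    Finset (V × V) :=
  Finset.univ.filter fun q => q.1 ∈ X ∧ q.2 ∉ X ∧ G.edist q.1 q.2 ≤ ℓ ∧
    ∃ w ∈ X, w ≠ q.1 ∧ G.edist q.1 w + G.edist w q.2 = G.edist q.1 q.2

theorem mem_blockedPairs {V : Type*} [Fintype V] {G : SimpleGraph V} {X : Finset V} {ℓ : ℕ}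
    {q : V × V} : q ∈ blockedPairs G X ℓ ↔ q.1 ∈ X ∧ q.2 ∉ X ∧ G.edist q.1 q.2 ≤ ℓ ∧
      ∃ w ∈ X, w ≠ q.1 ∧ G.edist q.1 w + G.edist w q.2 = G.edist q.1 q.2 := by
  simp [blockedPairs]

open Classical in
/-- The vertices at distance at most `ℓ` from `v`. -/
noncomputable def closedBall {V : Type*} [Fintype V] (G : SimpleGraph V) (v : V) (ℓ : ℕ) :
    Finset V :=
  Finset.univ.filter fun u => G.edist v u ≤ ℓ

/-- Since `X` is an initial segment of the order, all roots earlier than a root in `X` belong to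
`X`. A pair counted on the left thus has both ends in `X`, or is blocked, or produces a landmark. -/
theorem sum_card_closedBall_le_total {n : ℕ} {G : SimpleGraph (Fin n)}
    {pick : BFSState (Fin n) → Fin n} (hpick : IsExtractMin pick) (σ : Equiv.Perm (Fin n))
    (m ℓ : ℕ) {X : Finset (Fin n)} (hX : X = (Finset.univ.filter fun j : Fin n => j < m).image σ) :
    ∑ v ∈ X, (closedBall G v ℓ).card ≤
      (prunedLabeling pick (toDigraph G) (List.ofFn σ)).total + X.card ^ 2 +
        (blockedPairs G X ℓ).card := by
  classical
  set A : Finset (Fin n × Fin n) := Finset.univ.filter fun q => q.1 ∈ X ∧ G.edist q.1 q.2 ≤ ℓ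
  have hA : ∑ v ∈ X, (closedBall G v ℓ).card = A.card := by
    simp only [closedBall, A, Finset.card_filter]
    rw [← Finset.univ_product_univ, Finset.sum_product, ← Finset.sum_filter_add_sum_filter_not
      Finset.univ (· ∈ X), Finset.filter_univ_mem]
    rw [Finset.sum_eq_zero (s := Finset.univ.filter (· ∉ X))]
    · rw [add_zero]
      exact Finset.sum_congr rfl fun v hv => by simp [hv]
    · intro v hv
      simp [(Finset.mem_filter.mp hv).2]
  rw [hA]
  have hD : (A \ (X ×ˢ X ∪ blockedPairs G X ℓ)).card ≤
      (prunedLabeling pick (toDigraph G) (List.ofFn σ)).total := by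
    refine card_le_total fun q hq => ?_
    rw [Finset.mem_sdiff, Finset.mem_union, not_or] at hq
    obtain ⟨hqA, hqX, hqB⟩ := hq
    have hqA := (Finset.mem_filter.mp hqA).2
    have hq2 : q.2 ∉ X := fun h => hqX (Finset.mem_product.mpr ⟨hqA.1, h⟩)
    obtain ⟨i, hi, hiq⟩ := Finset.mem_image.mp (hX ▸ hqA.1)
    have him : (i : ℕ) < m := (Finset.mem_filter.mp hi).2
    rw [← hiq]
    refine prunedLabeling_ofFn_bwd_ne_top hpick σ.injective i ⟨?_, ?_⟩
    · rw [hiq]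
      exact ne_top_of_le_ne_top (ENat.natCast_ne_top ℓ) hqA.2
    · intro w hw
      obtain ⟨j, hj, rfl⟩ := Finset.mem_image.mp hw
      have hji : j < i := (Finset.mem_filter.mp hj).2
      rw [hiq]
      refine lt_of_le_of_ne SimpleGraph.edist_triangle fun heq => hqB ?_
      refine mem_blockedPairs.mpr ⟨hqA.1, hq2, hqA.2, σ j, ?_, ?_, heq.symm⟩
      · rw [hX]
        exact Finset.mem_image_of_mem _
          (Finset.mem_filter.mpr ⟨Finset.mem_univ _, lt_trans hji him⟩)
      · rw [← hiq]
        exact fun h => hji.ne (σ.injective h)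
  have h1 := Finset.card_le_card_sdiff_add_card (s := A) (t := X ×ˢ X ∪ blockedPairs G X ℓ)
  have h2 := Finset.card_union_le (X ×ˢ X) (blockedPairs G X ℓ)
  rw [Finset.card_product, ← sq] at h2
  lia

end Counting

end PrunedLabeling

namespace RandomGraph

/-! ### Random subsets of a finite set as finite weighted sums -/

section Bernoulli

variable {ι : Type*} {p : ℝ} {E F : Finset ι} {f g : Finset ι → ℝ}

/-- Expectation of `f` at a random subset of `E` that contains every element independently with
probability `p`. -/
noncomputable def bernExp (p : ℝ) (E : Finset ι) (f : Finset ι → ℝ) : ℝ :=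
  ∑ S ∈ E.powerset, p ^ S.card * (1 - p) ^ (E.card - S.card) * f S

theorem bernExp_congr (h : ∀ S ⊆ E, f S = g S) : bernExp p E f = bernExp p E g :=
  Finset.sum_congr rfl fun S hS => by rw [h S (Finset.mem_powerset.mp hS)]

theorem bernExp_const_mul (c : ℝ) : bernExp p E (fun S => c * f S) = c * bernExp p E f := by
  rw [bernExp, bernExp, Finset.mul_sum]
  exact Finset.sum_congr rfl fun S _ => by ring

theorem bernExp_const (c : ℝ) : bernExp p E (fun _ => c) = c := by
  rw [bernExp, ← Finset.sum_mul, Finset.sum_pow_mul_eq_add_pow]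
  simp

variable [DecidableEq ι]

/-- Fubini: the traces of the random set on two disjoint sets are independent. -/
theorem bernExp_union (h : Disjoint E F) :
    bernExp p (E ∪ F) f = bernExp p E fun S => bernExp p F fun T => f (S ∪ T) := by
  simp only [bernExp, Finset.mul_sum]
  rw [← Finset.sum_product']
  refine Finset.sum_nbij' (fun S => (S ∩ E, S ∩ F)) (fun q => q.1 ∪ q.2) ?_ ?_ ?_ ?_ ?_
  · intro S _
    simp [Finset.inter_subset_right]
  · intro q hq
    simp only [Finset.mem_product, Finset.mem_powerset] at hq ⊢
    exact Finset.union_subset_union hq.1 hq.2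
  · intro S hS
    simp only [← Finset.inter_union_distrib_left]
    exact Finset.inter_eq_left.mpr (Finset.mem_powerset.mp hS)
  · intro q hq
    simp only [Finset.mem_product, Finset.mem_powerset] at hq
    have h1 : q.2 ∩ E = ∅ := Finset.disjoint_iff_inter_eq_empty.mp (h.symm.mono_left hq.2)
    have h2 : q.1 ∩ F = ∅ := Finset.disjoint_iff_inter_eq_empty.mp (h.mono_left hq.1)
    ext1
    · simp only [Finset.union_inter_distrib_right, h1, Finset.union_empty]
      exact Finset.inter_eq_left.mpr hq.1
    · simp only [Finset.union_inter_distrib_right, h2, Finset.empty_union]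
      exact Finset.inter_eq_left.mpr hq.2
  · intro S hS
    have hSE := Finset.mem_powerset.mp hS
    have hS' : S ∩ E ∪ S ∩ F = S := by
      rw [← Finset.inter_union_distrib_left]
      exact Finset.inter_eq_left.mpr hSE
    have hd : Disjoint (S ∩ E) (S ∩ F) :=
      h.mono Finset.inter_subset_right Finset.inter_subset_right
    have hc : (S ∩ E).card + (S ∩ F).card = S.card := by
      rw [← Finset.card_union_of_disjoint hd, hS']
    have h1 : (S ∩ E).card ≤ E.card := Finset.card_le_card Finset.inter_subset_right
    have h2 : (S ∩ F).card ≤ F.card := Finset.card_le_card Finset.inter_subset_right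
    have h3 : (E ∪ F).card - S.card = (E.card - (S ∩ E).card) + (F.card - (S ∩ F).card) := by
      rw [Finset.card_union_of_disjoint h]
      lia
    dsimp only
    rw [hS', h3, ← hc, pow_add, pow_add]
    ring

theorem bernExp_mul (hFE : F ⊆ E) (hf : ∀ S ⊆ E, f S = f (S ∩ F)) (hg : ∀ S ⊆ E, g S = g (S \ F)) :
    bernExp p E (fun S => f S * g S) = bernExp p E f * bernExp p E g := by
  have hd : Disjoint F (E \ F) := Finset.disjoint_sdiff
  have hE : E = F ∪ (E \ F) := (Finset.union_sdiff_of_subset hFE).symm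
  have hfS : ∀ S ⊆ F, ∀ T ⊆ E \ F, f (S ∪ T) = f S := fun S hS T hT => by
    have hT' : T ∩ F = ∅ := Finset.disjoint_iff_inter_eq_empty.mp (hd.symm.mono_left hT)
    rw [hf _ (Finset.union_subset (hS.trans hFE) (hT.trans Finset.sdiff_subset)),
      Finset.union_inter_distrib_right, hT', Finset.union_empty, Finset.inter_eq_left.mpr hS]
  have hgS : ∀ S ⊆ F, ∀ T ⊆ E \ F, g (S ∪ T) = g T := fun S hS T hT => by
    rw [hg _ (Finset.union_subset (hS.trans hFE) (hT.trans Finset.sdiff_subset)),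
      Finset.union_sdiff_distrib, Finset.sdiff_eq_empty_iff_subset.mpr hS, Finset.empty_union,
      Finset.sdiff_eq_self_of_disjoint (hd.symm.mono_left hT)]
  have e1 : bernExp p E f = bernExp p F f := by
    conv_lhs => rw [hE]
    rw [bernExp_union hd]
    refine bernExp_congr fun S hS => ?_
    rw [bernExp_congr (g := fun _ => f S) fun T hT => hfS S hS T hT, bernExp_const]
  have e2 : bernExp p E g = bernExp p (E \ F) g := by
    conv_lhs => rw [hE]
    rw [bernExp_union hd, bernExp_congr (g := fun _ => bernExp p (E \ F) g) fun S hS =>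
      bernExp_congr fun T hT => hgS S hS T hT, bernExp_const]
  rw [e1, e2]
  conv_lhs => rw [hE]
  rw [bernExp_union hd]
  have e3 : bernExp p F (fun S => bernExp p (E \ F) fun T => f (S ∪ T) * g (S ∪ T)) =
      bernExp p F fun S => bernExp p (E \ F) g * f S := by
    refine bernExp_congr fun S hS => ?_
    rw [mul_comm, ← bernExp_const_mul]
    exact bernExp_congr fun T hT => by rw [hfS S hS T hT, hgS S hS T hT]
  rw [e3, bernExp_const_mul, mul_comm]

/-- If `f` depends only on the part of the random set in `F`, the other elements do not matter. -/
theorem bernExp_eq_of_subset (hFE : F ⊆ E) (hf : ∀ S ⊆ E, f S = f (S ∩ F)) :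
    bernExp p E f = bernExp p F f := by
  have hd : Disjoint F (E \ F) := Finset.disjoint_sdiff
  conv_lhs => rw [← Finset.union_sdiff_of_subset hFE]
  rw [bernExp_union hd]
  refine bernExp_congr fun S hS => ?_
  rw [bernExp_congr (g := fun _ => f S), bernExp_const]
  intro T hT
  have hT' : T ∩ F = ∅ := Finset.disjoint_iff_inter_eq_empty.mp (hd.symm.mono_left hT)
  rw [hf _ (Finset.union_subset (hS.trans hFE) (hT.trans Finset.sdiff_subset)),
      Finset.union_inter_distrib_right, hT', Finset.union_empty, Finset.inter_eq_left.mpr hS]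

theorem bernExp_subset (hFE : F ⊆ E) :
    bernExp p E (fun S => if F ⊆ S then 1 else 0) = p ^ F.card := by
  rw [bernExp_eq_of_subset hFE]
  · rw [bernExp, Finset.sum_eq_single F]
    · simp
    · intro S hS hne
      rw [if_neg, mul_zero]
      exact fun h => hne ((Finset.mem_powerset.mp hS).antisymm h)
    · simp
  · intro S _
    simp [Finset.subset_inter_iff]

theorem bernExp_disjoint (hFE : F ⊆ E) :
    bernExp p E (fun S => if Disjoint F S then 1 else 0) = (1 - p) ^ F.card := by
  rw [bernExp_eq_of_subset hFE]
  · rw [bernExp, Finset.sum_eq_single ∅]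
    · simp
    · intro S hS hne
      rw [if_neg, mul_zero]
      intro h
      exact hne (Finset.disjoint_self_iff_empty S |>.mp (h.mono_left (Finset.mem_powerset.mp hS)))
    · simp
  · intro S _
    congr 1
    rw [eq_iff_iff, Finset.disjoint_left, Finset.disjoint_left]
    exact ⟨fun h e he h' => h he (Finset.mem_inter.mp h').1,
      fun h e he h' => h he (Finset.mem_inter.mpr ⟨h', he⟩)⟩

end Bernoulli

/-! ### Expectation and independence for the binomial random graph -/

section DependsOnEdges

variable {V : Type*}

/-- The value of `f` at a graph is determined by the edges of the graph in `F`. -/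
def DependsOnEdges {α : Type*} (f : SimpleGraph V → α) (F : Set (Sym2 V)) : Prop :=
  ∀ G H : SimpleGraph V, (∀ e ∈ F, e ∈ G.edgeSet ↔ e ∈ H.edgeSet) → f G = f H

theorem DependsOnEdges.mono {α : Type*} {f : SimpleGraph V → α} {E F : Set (Sym2 V)}
    (h : DependsOnEdges f E) (hEF : E ⊆ F) : DependsOnEdges f F :=
  fun G H hGH => h G H fun e he => hGH e (hEF he)

theorem DependsOnEdges.comp {α β : Type*} {f : SimpleGraph V → α} {E : Set (Sym2 V)}
    (h : DependsOnEdges f E) (φ : α → β) : DependsOnEdges (fun G => φ (f G)) E :=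
  fun G H hGH => congrArg φ (h G H hGH)

theorem DependsOnEdges.prod {κ : Type*} {s : Finset κ} {f : κ → SimpleGraph V → ℝ}
    {E : Set (Sym2 V)} (h : ∀ i ∈ s, DependsOnEdges (f i) E) :
    DependsOnEdges (fun G => ∏ i ∈ s, f i G) E :=
  fun G H hGH => Finset.prod_congr rfl fun i hi => h i hi G H hGH

end DependsOnEdges

section Graph

variable {V : Type*} [Fintype V] {p : ℝ} {f g : SimpleGraph V → ℝ}

open Classical in
/-- The pairs of distinct vertices. -/
noncomputable def pairs (V : Type*) [Fintype V] : Finset (Sym2 V) :=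
  Finset.univ.filter fun e => ¬ e.IsDiag

/-- Expectation of `f` at the binomial random graph. -/
noncomputable def graphExp (p : ℝ) (f : SimpleGraph V → ℝ) : ℝ :=
  bernExp p (pairs V) fun S => f (SimpleGraph.fromEdgeSet S)

open Classical in
/-- Probability of `A` for the binomial random graph. -/
noncomputable def graphProb (p : ℝ) (A : SimpleGraph V → Prop) : ℝ :=
  graphExp p fun G => if A G then 1 else 0

theorem mem_edgeSet_fromEdgeSet {S : Finset (Sym2 V)} (hS : S ⊆ pairs V) (e : Sym2 V) :
    e ∈ (SimpleGraph.fromEdgeSet (S : Set (Sym2 V))).edgeSet ↔ e ∈ S := by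
  rw [SimpleGraph.edgeSet_fromEdgeSet]
  simp only [Set.mem_sdiff, Finset.mem_coe, and_iff_left_iff_imp]
  intro he
  simpa [pairs] using hS he

theorem graphExp_const (c : ℝ) : graphExp (V := V) p (fun _ => c) = c := bernExp_const c

theorem graphExp_const_mul (c : ℝ) : graphExp p (fun G => c * f G) = c * graphExp p f :=
  bernExp_const_mul c

theorem graphExp_sum {κ : Type*} (s : Finset κ) (f : κ → SimpleGraph V → ℝ) :
    graphExp p (fun G => ∑ i ∈ s, f i G) = ∑ i ∈ s, graphExp p (f i) := by
  simp only [graphExp, bernExp, Finset.mul_sum]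
  exact Finset.sum_comm

theorem graphExp_add : graphExp p (fun G => f G + g G) = graphExp p f + graphExp p g := by
  simp only [graphExp, bernExp, mul_add, Finset.sum_add_distrib]

theorem graphExp_mono (h0 : 0 ≤ p) (h1 : p ≤ 1) (h : ∀ G, f G ≤ g G) :
    graphExp p f ≤ graphExp p g := by
  refine Finset.sum_le_sum fun S _ => ?_
  have : 0 ≤ 1 - p := by linarith
  exact mul_le_mul_of_nonneg_left (h _) (by positivity)

theorem graphProb_le_one (h0 : 0 ≤ p) (h1 : p ≤ 1) (A : SimpleGraph V → Prop) :
    graphProb p A ≤ 1 := by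
  conv_rhs => rw [← graphExp_const (V := V) (p := p) 1]
  exact graphExp_mono h0 h1 fun G => by split_ifs <;> simp

theorem graphProb_eq_zero {A : SimpleGraph V → Prop} (h : ∀ G, ¬ A G) : graphProb p A = 0 := by
  rw [← graphExp_const (V := V) (p := p) 0]
  simp [graphProb, h]

theorem graphProb_mono (h0 : 0 ≤ p) (h1 : p ≤ 1) {A B : SimpleGraph V → Prop}
    (h : ∀ G, A G → B G) : graphProb p A ≤ graphProb p B :=
  graphExp_mono h0 h1 fun G => by
    by_cases hA : A G
    · simp [hA, h G hA]
    · rw [if_neg hA]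
      split_ifs <;> simp

theorem graphProb_or_le (h0 : 0 ≤ p) (h1 : p ≤ 1) (A B : SimpleGraph V → Prop) :
    graphProb p (fun G => A G ∨ B G) ≤ graphProb p A + graphProb p B := by
  rw [graphProb, graphProb, graphProb, ← graphExp_add]
  refine graphExp_mono h0 h1 fun G => ?_
  by_cases hA : A G <;> by_cases hB : B G <;> simp [hA, hB]

/-- Markov's inequality. -/
theorem graphProb_le_div (h0 : 0 ≤ p) (h1 : p ≤ 1) (hf : ∀ G, 0 ≤ f G) {t : ℝ} (ht : 0 < t) :
    graphProb p (fun G => t ≤ f G) ≤ graphExp p f / t := by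
  rw [div_eq_inv_mul, ← graphExp_const_mul]
  refine graphExp_mono h0 h1 fun G => ?_
  have hfG := hf G
  split_ifs with h
  · rw [← div_eq_inv_mul, one_le_div ht]
    exact h
  · positivity

theorem graphExp_mul {F : Set (Sym2 V)} (hf : DependsOnEdges f F) (hg : DependsOnEdges g Fᶜ) :
    graphExp p (fun G => f G * g G) = graphExp p f * graphExp p g := by
  classical
  refine bernExp_mul (F := (pairs V).filter (· ∈ F)) (Finset.filter_subset _ _) ?_ ?_
  · intro S hS
    refine hf _ _ fun e he => ?_
    rw [mem_edgeSet_fromEdgeSet hS, mem_edgeSet_fromEdgeSet (Finset.inter_subset_left.trans hS)]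
    simp only [Finset.mem_inter, Finset.mem_filter, he, and_true]
    exact ⟨fun h => ⟨h, hS h⟩, fun h => h.1⟩
  · intro S hS
    refine hg _ _ fun e he => ?_
    rw [mem_edgeSet_fromEdgeSet hS, mem_edgeSet_fromEdgeSet (Finset.sdiff_subset.trans hS)]
    have he' : e ∉ F := he
    simp [he']

theorem graphExp_prod {κ : Type*} (s : Finset κ) {f : κ → SimpleGraph V → ℝ}
    {F : κ → Set (Sym2 V)} (hf : ∀ i ∈ s, DependsOnEdges (f i) (F i))
    (hF : ∀ i ∈ s, ∀ j ∈ s, i ≠ j → Disjoint (F i) (F j)) :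
    graphExp p (fun G => ∏ i ∈ s, f i G) = ∏ i ∈ s, graphExp p (f i) := by
  classical
  induction s using Finset.induction_on with
  | empty => simpa using graphExp_const 1
  | insert a s ha ih =>
    simp only [Finset.prod_insert ha]
    rw [graphExp_mul (F := F a) (hf a (Finset.mem_insert_self _ _)),
      ih (fun i hi => hf i (Finset.mem_insert_of_mem hi))
      (fun i hi j hj => hF i (Finset.mem_insert_of_mem hi) j (Finset.mem_insert_of_mem hj))]
    refine DependsOnEdges.prod fun i hi => (hf i (Finset.mem_insert_of_mem hi)).mono ?_
    rw [Set.subset_compl_iff_disjoint_right]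
    exact hF i (Finset.mem_insert_of_mem hi) a (Finset.mem_insert_self _ _)
      (by rintro rfl; exact ha hi)

theorem graphProb_forall_mem {F : Finset (Sym2 V)} (hF : ∀ e ∈ F, ¬ e.IsDiag) :
    graphProb p (fun G => ∀ e ∈ F, e ∈ G.edgeSet) = p ^ F.card := by
  classical
  rw [← bernExp_subset (E := pairs V) (F := F) (fun e he => by simpa [pairs] using hF e he)]
  refine bernExp_congr fun S hS => ?_
  simp only [mem_edgeSet_fromEdgeSet hS]
  congr 1

theorem graphProb_forall_notMem {F : Finset (Sym2 V)} (hF : ∀ e ∈ F, ¬ e.IsDiag) :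
    graphProb p (fun G => ∀ e ∈ F, e ∉ G.edgeSet) = (1 - p) ^ F.card := by
  classical
  rw [← bernExp_disjoint (E := pairs V) (F := F) (fun e he => by simpa [pairs] using hF e he)]
  refine bernExp_congr fun S hS => ?_
  simp only [mem_edgeSet_fromEdgeSet hS, Finset.disjoint_left]

/-- This transfers the estimates from finite sums to the measure: an event is a finite union of edge
sets, each with its Bernoulli weight. -/
theorem binomialRandom_real (p : unitInterval) (A : Set (SimpleGraph V)) :
    (SimpleGraph.binomialRandom V p).real A = graphProb (p : ℝ) (· ∈ A) := by
  classical
  have hfin : (SimpleGraph.edgeSet '' A) =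
      ↑(((pairs V).powerset.filter fun S : Finset (Sym2 V) =>
          SimpleGraph.fromEdgeSet (S : Set (Sym2 V)) ∈ A).image
        fun S : Finset (Sym2 V) => (S : Set (Sym2 V))) := by
    ext T
    simp only [Set.mem_image, Finset.coe_image, Finset.coe_filter, Finset.mem_powerset,
      Set.mem_ofPred_eq]
    constructor
    · rintro ⟨G, hG, rfl⟩
      refine ⟨G.edgeFinset, ⟨fun e he => ?_, by simpa using hG⟩, by simp⟩
      simpa [pairs] using G.not_isDiag_of_mem_edgeFinset he
    · rintro ⟨S, ⟨hS, hA⟩, rfl⟩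
      exact ⟨_, hA, Set.ext fun e => by rw [mem_edgeSet_fromEdgeSet hS]; rfl⟩
  rw [MeasureTheory.measureReal_def, SimpleGraph.binomialRandom_apply',
    ← MeasureTheory.measureReal_def, hfin, ← MeasureTheory.sum_measureReal_singleton,
    Finset.sum_image (fun _ _ _ _ h => Finset.coe_injective h), graphProb, graphExp, bernExp,
    Finset.sum_filter]
  refine Finset.sum_congr rfl fun S hS => ?_
  have hSp := Finset.mem_powerset.mp hS
  have hsub : (S : Set (Sym2 V)) ⊆ Sym2.diagSetᶜ := fun e he => by
    simpa [pairs] using hSp he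
  have hc : (Sym2.diagSetᶜ \ (S : Set (Sym2 V))).ncard = (pairs V).card - S.card := by
    rw [← Finset.card_sdiff_of_subset hSp, ← Set.ncard_coe_finset]
    congr 1
    ext e
    simp [pairs]
  split_ifs with h
  · rw [ProbabilityTheory.setBernoulli_real_singleton p hsub (Set.toFinite _), hc,
      Set.ncard_coe_finset, mul_one]
  · simp

end Graph

end RandomGraph

namespace RandomGraph

/-! ### Growth of balls -/

section Exploration

variable {V : Type*} {G : SimpleGraph V}

open Classical in
/-- The vertices of `U` with a neighbor in `A`. -/
noncomputable def neighborsIn (G : SimpleGraph V) (A U : Finset V) : Finset V :=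
  U.filter fun u => ∃ a ∈ A, G.Adj a u

open Classical in
/-- The vertices of `U` that `ℓ` rounds of breadth-first search from `A` inside `U` do not find. -/
noncomputable def unexplored (G : SimpleGraph V) : ℕ → Finset V → Finset V → Finset V
  | 0, _, U => U
  | ℓ + 1, A, U => unexplored G ℓ (neighborsIn G A U) (U \ neighborsIn G A U)

theorem mem_neighborsIn {A U : Finset V} {u : V} :
    u ∈ neighborsIn G A U ↔ u ∈ U ∧ ∃ a ∈ A, G.Adj a u := by
  simp [neighborsIn]

theorem neighborsIn_subset (A U : Finset V) : neighborsIn G A U ⊆ U :=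
  fun _ hu => (mem_neighborsIn.mp hu).1

theorem unexplored_subset (ℓ : ℕ) : ∀ A U : Finset V, unexplored G ℓ A U ⊆ U := by
  classical
  induction ℓ with
  | zero => exact fun _ _ => subset_rfl
  | succ ℓ ih => exact fun A U => (ih _ _).trans (by convert Finset.sdiff_subset)

theorem exists_edist_le_of_notMem_unexplored (ℓ : ℕ) : ∀ (A U : Finset V) (v : V), v ∈ U →
    v ∉ unexplored G ℓ A U → ∃ a ∈ A, G.edist a v ≤ ℓ := by
  classical
  induction ℓ with
  | zero => exact fun A U v hv h => absurd hv h
  | succ ℓ ih =>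
    intro A U v hv h
    by_cases hN : v ∈ neighborsIn G A U
    · obtain ⟨-, a, ha, hadj⟩ := mem_neighborsIn.mp hN
      exact ⟨a, ha, (SimpleGraph.edist_eq_one_iff_adj.mpr hadj).le.trans (by simp)⟩
    · obtain ⟨b, hb, hbv⟩ := ih (neighborsIn G A U) (U \ neighborsIn G A U) v
        (Finset.mem_sdiff.mpr ⟨hv, hN⟩) (by convert h using 2; simp only [unexplored])
      obtain ⟨-, a, ha, hadj⟩ := mem_neighborsIn.mp hb
      refine ⟨a, ha, (SimpleGraph.edist_triangle (v := b)).trans ?_⟩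
      rw [SimpleGraph.edist_eq_one_iff_adj.mpr hadj, add_comm]
      push_cast
      gcongr

theorem dependsOnEdges_neighborsIn (A U : Finset V) :
    DependsOnEdges (fun G => neighborsIn G A U) {e | ∃ a ∈ A, ∃ u ∈ U, e = s(a, u)} := by
  intro G H h
  ext u
  simp only [mem_neighborsIn]
  refine and_congr_right fun hu => exists_congr fun a => and_congr_right fun ha => ?_
  simpa using h s(a, u) ⟨a, ha, u, hu, rfl⟩

/-- Deferred decisions: one round inspects only pairs between `A` and `U`, and all later rounds only
pairs inside `U`. These are disjoint sets of pairs, so the later rounds are independent of the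
current one. -/
theorem dependsOnEdges_unexplored (ℓ : ℕ) : ∀ {A U W : Finset V}, A ⊆ W → U ⊆ W →
    DependsOnEdges (fun G => unexplored G ℓ A U) {e | ∃ a ∈ W, ∃ u ∈ W, e = s(a, u)} := by
  classical
  induction ℓ with
  | zero => intro A U W _ _ G H _; rfl
  | succ ℓ ih =>
    intro A U W hA hU G H h
    have hN : neighborsIn G A U = neighborsIn H A U := by
      refine dependsOnEdges_neighborsIn A U G H fun e he => h e ?_
      obtain ⟨a, ha, u, hu, rfl⟩ := he
      exact ⟨a, hA ha, u, hU hu, rfl⟩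
    simp only [unexplored]
    rw [hN]
    refine ih ((neighborsIn_subset A U).trans hU) ?_ G H h
    exact Finset.sdiff_subset.trans hU

variable [Fintype V] {p : ℝ}

/-- Each vertex of `U` is missed independently with probability `(1 - p) ^ A.card`, so this is the
generating function of a binomial variable. -/
theorem graphExp_pow_card_neighborsIn {A U : Finset V} (hAU : Disjoint A U) (c : ℝ) :
    graphExp p (fun G => c ^ (neighborsIn G A U).card) =
      (c + (1 - c) * (1 - p) ^ A.card) ^ U.card := by
  classical
  have hmem : ∀ u ∈ U, u ∉ A := fun u hu ha => Finset.disjoint_left.mp hAU ha hu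
  set F : V → Finset (Sym2 V) := fun u => A.image fun a => s(a, u)
  have hprod : ∀ G : SimpleGraph V, c ^ (neighborsIn G A U).card =
      ∏ u ∈ U, (c + (1 - c) * if ∀ e ∈ F u, e ∉ G.edgeSet then 1 else 0) := by
    intro G
    rw [← Finset.prod_const, neighborsIn, Finset.prod_filter]
    refine Finset.prod_congr (by congr!) fun u _ => ?_
    have : (∀ e ∈ F u, e ∉ G.edgeSet) ↔ ¬ ∃ a ∈ A, G.Adj a u := by simp [F]
    simp only [this]
    by_cases h : ∃ a ∈ A, G.Adj a u
    · simp [h]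
    · rw [if_neg h, if_pos h]; ring
  simp only [hprod]
  rw [graphExp_prod (f := fun u G => c + (1 - c) * if ∀ e ∈ F u, e ∉ G.edgeSet then 1 else 0)
    (F := fun u => (F u : Set (Sym2 V)))]
  · rw [← Finset.prod_const]
    refine Finset.prod_congr rfl fun u hu => ?_
    have hcard : (F u).card = A.card :=
      Finset.card_image_of_injective _ fun a b hab => Sym2.congr_left.mp hab
    rw [graphExp_add, graphExp_const, graphExp_const_mul, ← hcard, ← graphProb_forall_notMem]
    · simp only [graphProb]
      congr!
    · intro e he
      obtain ⟨a, ha, rfl⟩ := Finset.mem_image.mp he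
      rw [Sym2.mk_isDiag_iff]
      rintro rfl
      exact hmem _ hu ha
  · intro u _ G H h
    have : (∀ e ∈ F u, e ∉ G.edgeSet) ↔ ∀ e ∈ F u, e ∉ H.edgeSet :=
      forall₂_congr fun e he => not_congr (h e he)
    simp only [this]
  · intro u hu v hv huv
    rw [Finset.disjoint_coe, Finset.disjoint_left]
    intro e he he'
    obtain ⟨a, ha, rfl⟩ := Finset.mem_image.mp he
    obtain ⟨b, hb, hab⟩ := Finset.mem_image.mp he'
    rcases Sym2.eq_iff.mp hab with ⟨_, h⟩ | ⟨h, _⟩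
    · exact huv h.symm
    · exact hmem u hu (h ▸ hb)

/-- One round of search for the Laplace transform of the number of vertices found. -/
theorem graphExp_exp_card_neighborsIn_le (hp : 0 < p) (h1 : p ≤ 1) {A U : Finset V}
    (hAU : Disjoint A U) {T ν μ : ℝ} (hμ : 0 < μ) (hA : A.card ≤ T) (hU : ν ≤ U.card)
    (hν : 0 < ν) :
    graphExp p (fun G => Real.exp (-((neighborsIn G A U).card / μ))) ≤
      Real.exp (-(A.card / ((μ + 1) / (ν * p / (1 + T * p))))) := by
  have hexp : ∀ G : SimpleGraph V, Real.exp (-((neighborsIn G A U).card / μ)) =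
      Real.exp (-(1 / μ)) ^ (neighborsIn G A U).card := by
    intro G
    rw [← Real.exp_nat_mul]
    congr 1
    ring
  simp only [hexp]
  rw [graphExp_pow_card_neighborsIn hAU]
  set a : ℝ := (A.card : ℝ) with ha
  have ha0 : 0 ≤ a := by positivity
  have hT0 : 0 ≤ T := ha0.trans hA
  -- This is `exp (-x) ≤ 1 / (1 + x)`, used for `x = a * p` and `x = 1 / μ`. Bounding `a` by `T`
  -- only in the denominator keeps the result linear in `a`.
  have frac : ∀ x : ℝ, 0 ≤ x → Real.exp (-x) ≤ 1 - x / (1 + x) := by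
    intro x hx
    rw [Real.exp_neg, one_sub_div (by positivity), add_sub_cancel_right, ← one_div]
    exact one_div_le_one_div_of_le (by positivity) (by linarith [Real.add_one_le_exp x])
  have hq : (1 - p) ^ A.card ≤ 1 - a * p / (1 + T * p) := by
    calc (1 - p) ^ A.card ≤ Real.exp (-p) ^ A.card :=
          pow_le_pow_left₀ (by linarith) (Real.one_sub_le_exp_neg p) _
      _ = Real.exp (-(a * p)) := by rw [← Real.exp_nat_mul]; congr 1; ring
      _ ≤ 1 - a * p / (1 + a * p) := frac _ (by positivity)
      _ ≤ 1 - a * p / (1 + T * p) := by gcongr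
  have hc : Real.exp (-(1 / μ)) ≤ 1 - 1 / (μ + 1) := by
    refine (frac (1 / μ) (by positivity)).trans (le_of_eq ?_)
    field_simp
  have hc0 : 0 < Real.exp (-(1 / μ)) := Real.exp_pos _
  set c := Real.exp (-(1 / μ))
  set q := (1 - p) ^ A.card
  set r := a * p / (1 + T * p) with hr
  have hr0 : 0 ≤ r := by positivity
  have hμ1 : 0 < 1 / (μ + 1) := by positivity
  have hq0 : 0 ≤ q := pow_nonneg (by linarith) _
  have hx : c + (1 - c) * q ≤ 1 - r / (μ + 1) := by
    have e : r / (μ + 1) = (1 / (μ + 1)) * r := by ring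
    rw [e]
    nlinarith
  calc (c + (1 - c) * q) ^ U.card ≤ Real.exp (-(r / (μ + 1))) ^ U.card := by
        refine pow_le_pow_left₀ ?_ (hx.trans (Real.one_sub_le_exp_neg _)) _
        have : c ≤ 1 := by linarith
        have := mul_nonneg (sub_nonneg.mpr this) hq0
        linarith
    _ = Real.exp (-(U.card * (r / (μ + 1)))) := by rw [← Real.exp_nat_mul]; congr 1; ring
    _ ≤ Real.exp (-(ν * (r / (μ + 1)))) := by gcongr
    _ = _ := by
        congr 2
        rw [hr]
        field_simp

/-- `Q` bounds the growth factor of a layer from below while fewer than `T` vertices are found. A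
round turns a failure bound `exp (-|B| / μ)` for the next layer `B` into `exp (-|A| / ((μ + 1) /
Q))` for `A`; iterating `μ ↦ (μ + 1) / Q` from about `T` stays below `T / Q ^ ℓ + 2 / Q`. The factor
`exp 1` makes the bound trivial for `ℓ = 0`. -/
theorem graphProb_unexplored_le (h0 : 0 < p) (h1 : p ≤ 1) {T Q : ℝ} (hT : 0 < T)
    (hTn : T < Fintype.card V)
    (hQ : Q = (Fintype.card V - T) * p / (1 + T * p)) (hQ2 : 2 ≤ Q) (ℓ : ℕ) :
    ∀ A U : Finset V, Disjoint A U →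
      graphProb p (fun G => Fintype.card V - T < (unexplored G ℓ A U).card) ≤
        Real.exp 1 * Real.exp (-(A.card / (T / Q ^ ℓ + 2 / Q))) := by
  classical
  have hQ0 : 0 < Q := by linarith
  have small : ∀ (ℓ : ℕ) (A U : Finset V), Disjoint A U → (A.card : ℝ) ≤ T →
      (Fintype.card V - T < U.card) ∨
      graphProb p (fun G => Fintype.card V - T < (unexplored G ℓ A U).card) = 0 := by
    intro ℓ A U _ _
    by_cases hU : (Fintype.card V : ℝ) - T < U.card
    · exact Or.inl hU
    · refine Or.inr (graphProb_eq_zero fun G h => hU (h.trans_le ?_))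
      exact_mod_cast Finset.card_le_card (unexplored_subset ℓ A U)
  -- Together with `small`, this excludes failure once a layer exceeds `T` or at most `n - T`
  -- vertices remain, so each round may assume the bounds behind `Q`.
  have large : ∀ (ℓ : ℕ) (A U : Finset V), Disjoint A U → T < A.card →
      graphProb p (fun G => Fintype.card V - T < (unexplored G ℓ A U).card) = 0 := by
    intro ℓ A U hAU hA
    refine graphProb_eq_zero fun G h => ?_
    have h2 : ((unexplored G ℓ A U).card : ℝ) ≤ U.card := by
      exact_mod_cast Finset.card_le_card (unexplored_subset ℓ A U)
    have h3 : (A.card : ℝ) + U.card ≤ Fintype.card V := by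
      rw [← Nat.cast_add, ← Finset.card_union_of_disjoint hAU]
      exact_mod_cast Finset.card_le_univ _
    linarith
  induction ℓ with
  | zero =>
    intro A U hAU
    rcases lt_or_ge T (A.card : ℝ) with hA | hA
    · rw [large 0 A U hAU hA]; positivity
    · refine (graphProb_le_one h0.le h1 _).trans ?_
      rw [← Real.exp_add, Real.one_le_exp_iff, pow_zero, div_one, ← sub_eq_add_neg, sub_nonneg,
        div_le_one (by positivity)]
      exact hA.trans (by have : 0 ≤ 2 / Q := by positivity
                         linarith)
  | succ ℓ ih =>
    intro A U hAU
    rcases lt_or_ge T (A.card : ℝ) with hA | hA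
    · rw [large _ A U hAU hA]; positivity
    rcases small (ℓ + 1) A U hAU hA with hU | hU
    swap
    · rw [hU]; positivity
    set μ : ℝ := T / Q ^ ℓ + 2 / Q with hμ
    have hμ0 : 0 < μ := by positivity
    set fail : SimpleGraph V → Finset V → ℝ := fun G B =>
      if Fintype.card V - T < (unexplored G ℓ B (U \ B)).card then 1 else 0
    -- Conditioning on the next layer `B`.
    have hsplit : graphProb p (fun G => Fintype.card V - T < (unexplored G (ℓ + 1) A U).card) =
        ∑ B ∈ U.powerset, graphExp p (fun G => (if neighborsIn G A U = B then 1 else 0) *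
          fail G B) := by
      rw [← graphExp_sum, graphProb]
      congr 1
      funext G
      rw [Finset.sum_eq_single (neighborsIn G A U)]
      · simp only [if_true, one_mul, fail, unexplored]
        congr!
      · intro B _ hB
        rw [if_neg hB.symm, zero_mul]
      · intro h
        exact absurd (Finset.mem_powerset.mpr (neighborsIn_subset A U)) h
    have hterm : ∀ B ∈ U.powerset,
        graphExp p (fun G => (if neighborsIn G A U = B then 1 else 0) * fail G B) ≤
        graphExp p (fun G => (if neighborsIn G A U = B then 1 else 0) *
          (Real.exp 1 * Real.exp (-((neighborsIn G A U).card / μ)))) := by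
      intro B hB
      have hBU := Finset.mem_powerset.mp hB
      rw [graphExp_mul (F := {e | ∃ a ∈ A, ∃ u ∈ U, e = s(a, u)})]
      · have hfail : graphExp p (fun G => fail G B) ≤
            Real.exp 1 * Real.exp (-(B.card / μ)) := by
          refine le_trans (le_of_eq ?_) (ih B (U \ B) Finset.disjoint_sdiff)
          simp only [graphProb, fail]
        have hN0 : 0 ≤ graphExp p fun G => if neighborsIn G A U = B then (1 : ℝ) else 0 := by
          refine (graphExp_const (V := V) (p := p) 0).symm.trans_le
            (graphExp_mono h0.le h1 fun G => ?_)
          split_ifs <;> simp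
        refine (mul_le_mul_of_nonneg_left hfail hN0).trans (le_of_eq ?_)
        rw [mul_comm, ← graphExp_const_mul]
        congr 1
        funext G
        split_ifs with h
        · rw [h]; ring
        · ring
      · exact (dependsOnEdges_neighborsIn A U).comp fun N => if N = B then (1 : ℝ) else 0
      · refine DependsOnEdges.mono (((dependsOnEdges_unexplored ℓ hBU
          (Finset.sdiff_subset (s := U) (t := B)))).comp
          fun R => if (Fintype.card V : ℝ) - T < R.card then (1 : ℝ) else 0) ?_
        rintro e ⟨a, ha, u, hu, rfl⟩ ⟨b, hb, w, -, hbw⟩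
        rcases Sym2.eq_iff.mp hbw with ⟨h, _⟩ | ⟨_, h⟩
        · exact Finset.disjoint_left.mp hAU hb (h ▸ ha)
        · exact Finset.disjoint_left.mp hAU hb (h ▸ hu)
    rw [hsplit]
    refine (Finset.sum_le_sum hterm).trans ?_
    rw [← graphExp_sum]
    have hsum : (fun G : SimpleGraph V => ∑ B ∈ U.powerset,
        (if neighborsIn G A U = B then (1 : ℝ) else 0) *
          (Real.exp 1 * Real.exp (-((neighborsIn G A U).card / μ)))) =
        fun G => Real.exp 1 * Real.exp (-((neighborsIn G A U).card / μ)) := by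
      funext G
      rw [← Finset.sum_mul, Finset.sum_ite_eq, if_pos, one_mul]
      exact Finset.mem_powerset.mpr (neighborsIn_subset A U)
    rw [hsum, graphExp_const_mul]
    refine mul_le_mul_of_nonneg_left ?_ (Real.exp_pos _).le
    refine (graphExp_exp_card_neighborsIn_le h0 h1 hAU hμ0 hA hU.le (by linarith)).trans ?_
    rw [← hQ]
    -- The additive term reproduces itself because `2 / Q + 1 ≤ 2`.
    have hle : (μ + 1) / Q ≤ T / Q ^ (ℓ + 1) + 2 / Q := by
      have e : T / Q ^ (ℓ + 1) = T / Q ^ ℓ / Q := by rw [pow_succ, div_div]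
      rw [e, ← add_div, hμ]
      have : 2 / Q ≤ 1 := by rw [div_le_one hQ0]; exact hQ2
      exact div_le_div_of_nonneg_right (by linarith) hQ0.le
    gcongr

/-- Balls of radius `ℓ` are large with high probability. -/
theorem graphProb_closedBall_lt_le (h0 : 0 < p) (h1 : p ≤ 1) {T Q : ℝ} (hT : 0 < T)
    (hTn : T < Fintype.card V)
    (hQ : Q = (Fintype.card V - T) * p / (1 + T * p)) (hQ2 : 2 ≤ Q) (ℓ : ℕ) (v : V) :
    graphProb p (fun G => (PrunedLabeling.closedBall G v ℓ).card < T) ≤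
      Real.exp 1 * Real.exp (-(1 / (T / Q ^ ℓ + 2 / Q))) := by
  classical
  have h := graphProb_unexplored_le h0 h1 hT hTn hQ hQ2 ℓ {v} (Finset.univ \ {v})
    Finset.disjoint_sdiff
  rw [Finset.card_singleton, Nat.cast_one] at h
  refine le_trans (graphProb_mono h0.le h1 fun G hG => ?_) h
  have hsub : (PrunedLabeling.closedBall G v ℓ)ᶜ ⊆ unexplored G ℓ {v} (Finset.univ \ {v}) := by
    intro u hu
    by_contra hcon
    have hu' : ¬ G.edist v u ≤ ℓ := by simpa [PrunedLabeling.closedBall] using hu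
    have huv : u ≠ v := by rintro rfl; simp at hu'
    obtain ⟨a, ha, hle⟩ := exists_edist_le_of_notMem_unexplored ℓ {v} (Finset.univ \ {v}) u
      (by simpa using huv) hcon
    exact hu' (Finset.mem_singleton.mp ha ▸ hle)
  have hc := Finset.card_le_card hsub
  rw [Finset.card_compl] at hc
  have hc' : (Fintype.card V : ℝ) ≤ (unexplored G ℓ {v} (Finset.univ \ {v})).card +
      (PrunedLabeling.closedBall G v ℓ).card := by exact_mod_cast Nat.sub_le_iff_le_add.mp hc
  linarith

end Exploration

end RandomGraph

namespace RandomGraph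

/-! ### First moment of blocked pairs -/

section Paths

variable {V : Type*} [Fintype V]

open Classical in
/-- The sequences of `ℓ + 1` distinct vertices whose entries `0` and `a` lie in `X`. -/
noncomputable def sequences (X : Finset V) (ℓ : ℕ) (a : Fin (ℓ + 1)) :
    Finset (Fin (ℓ + 1) → V) :=
  Finset.univ.filter fun f => f.Injective ∧ f 0 ∈ X ∧ f a ∈ X

/-- Consecutive entries of `f` are adjacent. -/
def IsPathIn {ℓ : ℕ} (G : SimpleGraph V) (f : Fin (ℓ + 1) → V) : Prop :=
  ∀ i : Fin ℓ, G.Adj (f i.castSucc) (f i.succ)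

theorem card_sequences_le (X : Finset V) (ℓ : ℕ) (a : Fin (ℓ + 1)) (ha : a ≠ 0) :
    (sequences X ℓ a).card ≤ X.card ^ 2 * Fintype.card V ^ (ℓ - 1) := by
  classical
  have hsub : sequences X ℓ a ⊆
      Fintype.piFinset fun i => if i ∈ ({0, a} : Finset (Fin (ℓ + 1))) then X else Finset.univ := by
    intro f hf
    obtain ⟨-, h0, h1⟩ := (Finset.mem_filter.mp hf).2
    rw [Fintype.mem_piFinset]
    intro i
    split_ifs with h
    · rcases Finset.mem_insert.mp h with rfl | h
      · exact h0
      · rw [Finset.mem_singleton.mp h]; exact h1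
    · exact Finset.mem_univ _
  refine (Finset.card_le_card hsub).trans (le_of_eq ?_)
  rw [Fintype.card_piFinset]
  simp only [apply_ite Finset.card, Finset.card_univ]
  rw [Finset.prod_ite, Finset.prod_const, Finset.prod_const, Finset.filter_univ_mem,
    Finset.card_pair ha.symm, Finset.filter_not, Finset.filter_univ_mem,
    Finset.card_sdiff_of_subset (Finset.subset_univ _), Finset.card_pair ha.symm]
  simp

theorem graphProb_isPathIn {p : ℝ} {ℓ : ℕ} {f : Fin (ℓ + 1) → V} (hf : f.Injective) :
    graphProb p (fun G => IsPathIn G f) = p ^ ℓ := by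
  classical
  set F : Finset (Sym2 V) := Finset.univ.image fun i : Fin ℓ => s(f i.castSucc, f i.succ)
  have hcard : F.card = ℓ := by
    rw [Finset.card_image_of_injective, Finset.card_univ, Fintype.card_fin]
    intro i j hij
    rcases Sym2.eq_iff.mp hij with ⟨h, _⟩ | ⟨h, h'⟩
    · exact Fin.castSucc_injective _ (hf h)
    · have h1 := congrArg Fin.val (hf h)
      have h2 := congrArg Fin.val (hf h')
      simp only [Fin.val_castSucc, Fin.val_succ] at h1 h2
      lia
  conv_rhs => rw [← hcard]
  rw [← graphProb_forall_mem]
  · congr 1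
    funext G
    simp [F, IsPathIn]
  · intro e he
    obtain ⟨i, -, rfl⟩ := Finset.mem_image.mp he
    rw [Sym2.mk_isDiag_iff]
    exact fun h => Fin.castSucc_lt_succ.ne (hf h)

open Classical in
-- Joining shortest walks from the root to the blocking vertex `w` and on to the endpoint gives a
-- geodesic, hence distinct vertices, with `w` at a nonzero position `a`. The pair is recovered from
-- the two ends of the sequence.
theorem card_blockedPairs_le (G : SimpleGraph V) (X : Finset V) (L : ℕ) :
    (PrunedLabeling.blockedPairs G X L).card ≤ ∑ ℓ ∈ Finset.range (L + 1),
      ∑ a ∈ Finset.univ.filter (fun a : Fin (ℓ + 1) => a ≠ 0),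
        ((sequences X ℓ a).filter fun f => IsPathIn G f).card := by
  have hsub : PrunedLabeling.blockedPairs G X L ⊆ (Finset.range (L + 1)).biUnion fun ℓ =>
      (Finset.univ.filter (fun a : Fin (ℓ + 1) => a ≠ 0)).biUnion fun a =>
        ((sequences X ℓ a).filter fun f => IsPathIn G f).image fun f => (f 0, f (Fin.last ℓ)) := by
    rintro ⟨v, u⟩ hq
    obtain ⟨hv, -, hle, w, hw, hwv, heq⟩ := PrunedLabeling.mem_blockedPairs.mp hq
    dsimp only at hv hle hwv heq
    have hfin : G.edist v u ≠ ⊤ := ne_top_of_le_ne_top (ENat.natCast_ne_top L) hle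
    rw [← heq] at hfin
    obtain ⟨P, hP⟩ := SimpleGraph.exists_walk_of_edist_ne_top (ne_top_of_le_ne_top hfin le_self_add)
    obtain ⟨R, hR⟩ := SimpleGraph.exists_walk_of_edist_ne_top (ne_top_of_le_ne_top hfin le_add_self)
    set W := P.append R with hWdef
    have hlen : W.length = P.length + R.length := SimpleGraph.Walk.length_append _ _
    have hW : (W.length : ℕ∞) = G.edist v u := by
      rw [hlen, Nat.cast_add, hP, hR, heq]
    have hpath : W.IsPath := by
      apply SimpleGraph.Walk.isPath_of_length_eq_dist
      rw [SimpleGraph.dist, ← hW, ENat.toNat_natCast]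
    have hWL : W.length ≤ L := by
      rw [← hW] at hle
      exact_mod_cast hle
    have hP0 : P.length ≠ 0 := fun h => hwv (SimpleGraph.Walk.eq_of_length_eq_zero h).symm
    refine Finset.mem_biUnion.mpr ⟨W.length, Finset.mem_range.mpr (by lia), ?_⟩
    refine Finset.mem_biUnion.mpr ⟨⟨P.length, by lia⟩, ?_, ?_⟩
    · rw [Finset.mem_filter]
      exact ⟨Finset.mem_univ _, fun h => hP0 (congrArg Fin.val h)⟩
    refine Finset.mem_image.mpr ⟨fun i => W.getVert i, ?_, ?_⟩
    · rw [Finset.mem_filter, sequences, Finset.mem_filter]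
      refine ⟨⟨Finset.mem_univ _, ?_, ?_, ?_⟩, ?_⟩
      · intro i j hij
        exact Fin.ext (hpath.getVert_injOn (show (i : ℕ) ≤ W.length by lia)
          (show (j : ℕ) ≤ W.length by lia) hij)
      · simpa using hv
      · have : W.getVert P.length = w := by
          rw [hWdef, SimpleGraph.Walk.getVert_append]
          simp
        simpa [this] using hw
      · intro i
        exact W.adj_getVert_succ i.2
    · simp
  refine (Finset.card_le_card hsub).trans (Finset.card_biUnion_le.trans ?_)
  refine Finset.sum_le_sum fun ℓ _ => Finset.card_biUnion_le.trans ?_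
  exact Finset.sum_le_sum fun a _ => Finset.card_image_le

/-- Two of the `ℓ + 1` entries are confined to `X`, so length `ℓ` and position `a` contribute at
most `|X|^2 n^(ℓ-1) p^ℓ = |X|^2 (np)^ℓ / n`. As `np ≥ 1`, the longest length dominates; there are at
most `(L + 1)^2` choices of `ℓ` and `a`. -/
theorem graphExp_card_blockedPairs_le {p : ℝ} (h0 : 0 ≤ p) (h1 : p ≤ 1)
    (hn : 1 ≤ Fintype.card V * p) (X : Finset V) (L : ℕ) :
    graphExp p (fun G => ((PrunedLabeling.blockedPairs G X L).card : ℝ)) ≤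
      (L + 1) ^ 2 * (X.card ^ 2 * ((Fintype.card V * p) ^ L / Fintype.card V)) := by
  classical
  set n : ℝ := (Fintype.card V : ℝ) with hndef
  have hn0 : 0 < n := by
    by_contra h
    have : n = 0 := le_antisymm (not_lt.mp h) (by positivity)
    rw [this, zero_mul] at hn
    linarith
  have hterm : ∀ ℓ ∈ Finset.range (L + 1), ∀ a : Fin (ℓ + 1), a ≠ 0 →
      graphExp p (fun G => (((sequences X ℓ a).filter fun f => IsPathIn G f).card : ℝ)) ≤
        X.card ^ 2 * ((n * p) ^ L / n) := by
    intro ℓ hℓ a ha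
    have hℓ0 : ℓ ≠ 0 := by
      rintro rfl
      exact ha (Fin.ext (by lia))
    obtain ⟨k, rfl⟩ := Nat.exists_eq_succ_of_ne_zero hℓ0
    have e : ∀ G : SimpleGraph V,
        (((sequences X (k + 1) a).filter fun f => IsPathIn G f).card : ℝ) =
          ∑ f ∈ sequences X (k + 1) a, if IsPathIn G f then 1 else 0 := by
      intro G
      rw [Finset.card_filter]
      push_cast
      rfl
    simp only [Nat.succ_eq_add_one, e]
    rw [graphExp_sum]
    have e2 : ∀ f ∈ sequences X (k + 1) a,
        graphExp p (fun G => if IsPathIn G f then (1 : ℝ) else 0) = p ^ (k + 1) := by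
      intro f hf
      rw [← graphProb_isPathIn (Finset.mem_filter.mp hf).2.1, graphProb]
    rw [Finset.sum_congr rfl e2, Finset.sum_const, nsmul_eq_mul]
    have hc : ((sequences X (k + 1) a).card : ℝ) ≤ X.card ^ 2 * n ^ k := by
      rw [hndef]
      exact_mod_cast card_sequences_le X (k + 1) a ha
    calc ((sequences X (k + 1) a).card : ℝ) * p ^ (k + 1)
        ≤ X.card ^ 2 * n ^ k * p ^ (k + 1) := by gcongr
      _ = X.card ^ 2 * ((n * p) ^ (k + 1) / n) := by
        rw [mul_pow]
        field_simp
        ring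
      _ ≤ X.card ^ 2 * ((n * p) ^ L / n) := by
        have hk : k + 1 ≤ L := by simpa [Nat.lt_succ_iff] using hℓ
        gcongr
  set C : ℝ := X.card ^ 2 * ((n * p) ^ L / n) with hC
  have hC0 : 0 ≤ C := by
    have : 0 ≤ n * p := by linarith
    positivity
  calc graphExp p (fun G => ((PrunedLabeling.blockedPairs G X L).card : ℝ))
      ≤ graphExp p (fun G => ∑ ℓ ∈ Finset.range (L + 1),
          ∑ a ∈ Finset.univ.filter (fun a : Fin (ℓ + 1) => a ≠ 0),
            (((sequences X ℓ a).filter fun f => IsPathIn G f).card : ℝ)) :=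
        graphExp_mono h0 h1 fun G => by exact_mod_cast card_blockedPairs_le G X L
    _ = ∑ ℓ ∈ Finset.range (L + 1), ∑ a ∈ Finset.univ.filter (fun a : Fin (ℓ + 1) => a ≠ 0),
          graphExp p (fun G => (((sequences X ℓ a).filter fun f => IsPathIn G f).card : ℝ)) := by
        rw [graphExp_sum]
        exact Finset.sum_congr rfl fun ℓ _ => graphExp_sum _ _
    _ ≤ ∑ ℓ ∈ Finset.range (L + 1), (L + 1) * C := by
        refine Finset.sum_le_sum fun ℓ hℓ => ?_
        refine (Finset.sum_le_sum fun a ha => hterm ℓ hℓ a (Finset.mem_filter.mp ha).2).trans ?_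
        rw [Finset.sum_const, nsmul_eq_mul]
        refine mul_le_mul_of_nonneg_right ?_ hC0
        have h2 : (Finset.univ.filter (fun a : Fin (ℓ + 1) => a ≠ 0)).card ≤ L + 1 :=
          (Finset.card_le_univ _).trans (by
            rw [Fintype.card_fin]; exact Finset.mem_range.mp hℓ)
        exact_mod_cast h2
    _ = (L + 1) ^ 2 * C := by
        rw [Finset.sum_const, Finset.card_range, nsmul_eq_mul]
        push_cast
        ring

end Paths

end RandomGraph

/-! ### Combination of the estimates and choice of parameters -/

namespace RandomGraph

open PrunedLabeling

theorem graphExp_card_smallBalls_le {V : Type*} [Fintype V] {p ε T : ℝ} {X : Finset V} {L : ℕ}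
    (h : ∀ v, graphProb p (fun G : SimpleGraph V => (closedBall G v L).card < T) ≤ ε) :
    graphExp p (fun G => ((X.filter fun v => (closedBall G v L).card < T).card : ℝ)) ≤
      X.card * ε := by
  have e : ∀ G : SimpleGraph V, ((X.filter fun v => (closedBall G v L).card < T).card : ℝ) =
      ∑ v ∈ X, if ((closedBall G v L).card : ℝ) < T then 1 else 0 := by
    intro G
    rw [Finset.card_filter]
    push_cast
    rfl
  simp only [e]
  rw [graphExp_sum, ← nsmul_eq_mul]
  refine Finset.sum_le_card_nsmul X _ ε fun v _ => le_trans (le_of_eq ?_) (h v)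
  rw [graphProb]

theorem le_binomialRandom_le_total {n m L : ℕ} (p : unitInterval) (σ : Equiv.Perm (Fin n))
    (hm0 : 0 < m) (hmn : m ≤ n) {T ε : ℝ} (hT : 0 < T) (hmT : 8 * (m : ℝ) ≤ T)
    (hnp : 1 ≤ (n : ℝ) * p)
    (h : ∀ v : Fin n, graphProb p (fun G => (closedBall G v L).card < T) ≤ ε) :
    1 - 2 * ε - 8 * (L + 1) ^ 2 * m * ((n * p) ^ L / n) / T ≤
      (SimpleGraph.binomialRandom (Fin n) p).real {G | ∀ pick : BFSState (Fin n) → Fin n,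
        IsExtractMin pick →
          m * T / 4 ≤ ((prunedLabeling pick (toDigraph G) (List.ofFn σ)).total : ℝ)} := by
  classical
  have h0 : (0 : ℝ) ≤ p := p.2.1
  have h1 : (p : ℝ) ≤ 1 := p.2.2
  have hm : (0 : ℝ) < m := by exact_mod_cast hm0
  obtain ⟨X, hX⟩ : ∃ X, X = (Finset.univ.filter fun j : Fin n => (j : ℕ) < m).image σ := ⟨_, rfl⟩
  have hcard : X.card = m := by
    rw [hX, Finset.card_image_of_injective _ σ.injective, Fin.card_filter_val_lt]
    exact min_eq_right hmn
  set small : SimpleGraph (Fin n) → ℝ := fun G =>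
    ((X.filter fun v => (closedBall G v L).card < T).card : ℝ)
  set blocked : SimpleGraph (Fin n) → ℝ := fun G => ((blockedPairs G X L).card : ℝ)
  rw [binomialRandom_real]
  set A : SimpleGraph (Fin n) → Prop := fun G => ∀ pick : BFSState (Fin n) → Fin n,
    IsExtractMin pick →
      m * T / 4 ≤ ((prunedLabeling pick (toDigraph G) (List.ofFn σ)).total : ℝ) with hA
  -- If fewer than half of the roots have small balls, there are at least `mT/2` pairs; removing
  -- `m^2 ≤ mT/8` inner pairs and at most `mT/8` blocked ones leaves `mT/4`.
  have hcover : ∀ G, A G ∨ m / 2 ≤ small G ∨ m * T / 8 ≤ blocked G := by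
    intro G
    by_contra hcon
    push Not at hcon
    obtain ⟨hnA, hs, hb⟩ := hcon
    refine hnA fun pick hpick => ?_
    have hsum := sum_card_closedBall_le_total (G := G) hpick σ m L hX
    rw [hcard] at hsum
    have hsum' : (∑ v ∈ X, ((closedBall G v L).card : ℝ)) ≤
        (prunedLabeling pick (toDigraph G) (List.ofFn σ)).total + (m : ℝ) ^ 2 + blocked G := by
      simp only [blocked]
      exact_mod_cast hsum
    have hlow : (m / 2) * T ≤ ∑ v ∈ X, ((closedBall G v L).card : ℝ) := by
      have hc : ((X.filter fun v => ¬ ((closedBall G v L).card : ℝ) < T).card : ℝ) =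
          m - small G := by
        rw [eq_sub_iff_add_eq, ← hcard, ← X.card_filter_add_card_filter_not
          (fun v => ((closedBall G v L).card : ℝ) < T)]
        push_cast
        rw [add_comm]
      calc (m / 2) * T ≤ (X.filter fun v => ¬ ((closedBall G v L).card : ℝ) < T).card * T := by
            rw [hc]
            gcongr
            linarith
        _ ≤ ∑ v ∈ X.filter fun v => ¬ ((closedBall G v L).card : ℝ) < T,
            ((closedBall G v L).card : ℝ) := by
            rw [← nsmul_eq_mul]
            exact Finset.card_nsmul_le_sum _ _ _ fun v hv => not_lt.mp (Finset.mem_filter.mp hv).2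
        _ ≤ _ := Finset.sum_le_sum_of_subset_of_nonneg (Finset.filter_subset _ _)
            fun _ _ _ => Nat.cast_nonneg _
    nlinarith
  have hone : (1 : ℝ) ≤ graphProb p A + (graphProb p (fun G => m / 2 ≤ small G) +
      graphProb p (fun G => m * T / 8 ≤ blocked G)) := by
    calc (1 : ℝ) = graphExp p (fun _ : SimpleGraph (Fin n) => 1) := (graphExp_const 1).symm
      _ ≤ graphProb p (fun G => A G ∨ m / 2 ≤ small G ∨ m * T / 8 ≤ blocked G) := by
          rw [graphProb]
          refine graphExp_mono h0 h1 fun G => ?_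
          rw [if_pos (hcover G)]
      _ ≤ _ := (graphProb_or_le h0 h1 _ _).trans
          (add_le_add le_rfl (graphProb_or_le h0 h1 _ _))
  have hsmall : graphProb p (fun G => m / 2 ≤ small G) ≤ 2 * ε := by
    refine (graphProb_le_div h0 h1 (fun _ => Nat.cast_nonneg _) (by positivity)).trans ?_
    rw [div_le_iff₀ (by positivity)]
    have := graphExp_card_smallBalls_le (X := X) h
    rw [hcard] at this
    calc _ ≤ _ := this
      _ = _ := by ring
  have hblocked : graphProb p (fun G => m * T / 8 ≤ blocked G) ≤
      8 * (L + 1) ^ 2 * m * ((n * p) ^ L / n) / T := by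
    refine (graphProb_le_div h0 h1 (fun _ => Nat.cast_nonneg _) (by positivity)).trans ?_
    have := graphExp_card_blockedPairs_le h0 h1 (by simpa using hnp) X L
    rw [hcard, Fintype.card_fin] at this
    rw [div_le_iff₀ (by positivity)]
    refine this.trans (le_of_eq ?_)
    field_simp
  have hAA : graphProb p A = graphProb p (· ∈ {G | A G}) := rfl
  linarith

/-- The bounds for one value of `n` with logarithm `l`. -/
theorem le_binomialRandom_le_total_of_log {n : ℕ} (σ : Equiv.Perm (Fin n))
    (hl : 6 ≤ Real.log n) (hn : Real.log n ^ 8 ≤ n) :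
    1 - 2 * (Real.exp 1 * Real.exp (-(Real.log n / 3))) - 32 / Real.log n ^ 3 ≤
      (SimpleGraph.binomialRandom (Fin n) (edgeProb n)).real
        {G | ∀ pick : BFSState (Fin n) → Fin n, IsExtractMin pick →
          1 / 8 * (n : ℝ) ^ 2 / Real.log n ^ 11 ≤
            ((prunedLabeling pick (toDigraph G) (List.ofFn σ)).total : ℝ)} := by
  obtain ⟨l, hldef⟩ : ∃ l, l = Real.log n := ⟨_, rfl⟩
  rw [← hldef] at hl hn ⊢
  have hl0 : 0 < l := by linarith
  have hn0 : (0 : ℝ) < n := lt_of_lt_of_le (by positivity) hn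
  have hn1 : (1 : ℝ) ≤ n := by
    have : 0 < n := by exact_mod_cast hn0
    exact_mod_cast this
  have hexp : Real.exp l = n := by rw [hldef, Real.exp_log hn0]
  have hp : ((edgeProb n : unitInterval) : ℝ) = 2 * l / n := by rw [hldef]; rfl
  have hnp : (n : ℝ) * (edgeProb n : unitInterval) = 2 * l := by rw [hp]; field_simp
  set T : ℝ := n / l ^ 3 with hT
  have hT0 : 0 < T := by positivity
  have hTn : T < n := div_lt_self hn0 (one_lt_pow₀ (by linarith) (by norm_num))
  -- The maximal radius with `(2l)^L ≤ n` keeps the path count at most `m^2` per length and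
  -- position, while balls already reach size `T`.
  obtain ⟨L, hL1, hL2⟩ := exists_nat_pow_near hn1 (show (1 : ℝ) < 2 * l by linarith)
  have hLl : (L : ℝ) ≤ l := by
    rw [← Real.exp_le_exp, hexp]
    refine le_trans ?_ hL1
    rw [← Real.exp_one_pow]
    have := Real.exp_one_lt_d9
    gcongr
    linarith
  obtain ⟨m, hm⟩ : ∃ m, m = ⌊(n : ℝ) / l ^ 8⌋₊ := ⟨_, rfl⟩
  have hone : 1 ≤ (n : ℝ) / l ^ 8 := by rwa [one_le_div (by positivity)]
  have hm0 : 0 < m := by rw [hm]; exact Nat.floor_pos.mpr hone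
  have hmle : (m : ℝ) ≤ n / l ^ 8 := by rw [hm]; exact Nat.floor_le (by positivity)
  have hmge : n / l ^ 8 / 2 ≤ (m : ℝ) := by
    have h1 : n / l ^ 8 < (m : ℝ) + 1 := by rw [hm]; exact Nat.lt_floor_add_one _
    have h2 : (1 : ℝ) ≤ m := by exact_mod_cast hm0
    linarith
  have hmn : m ≤ n := by
    have : (m : ℝ) ≤ n := hmle.trans (div_le_self hn0.le (one_le_pow₀ (by linarith)))
    exact_mod_cast this
  have hmT' : (m : ℝ) ≤ T / l ^ 5 := by
    rw [hT, div_div, ← pow_add]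
    exact hmle
  have hmT : 8 * (m : ℝ) ≤ T := by
    rw [le_div_iff₀ (by positivity)] at hmT'
    have h5 : (8 : ℝ) ≤ l ^ 5 := by
      calc (8 : ℝ) ≤ 6 ^ 5 := by norm_num
        _ ≤ l ^ 5 := by gcongr
    nlinarith [(Nat.cast_nonneg m : (0 : ℝ) ≤ m)]
  obtain ⟨Q, hQ⟩ : ∃ Q, Q = (n - T) * (2 * l / n) / (1 + T * (2 * l / n)) := ⟨_, rfl⟩
  have hinv : 0 < l⁻¹ := by positivity
  have hinv1 : l⁻¹ ≤ 1 / 6 := by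
    rw [inv_eq_one_div]
    exact one_div_le_one_div_of_le (by norm_num) hl
  -- The choice of `T` makes `T * p = 2 / l^2`, so `Q` loses only a factor `1 - 3 / l^2` against the
  -- mean degree. Over `L ≤ l` rounds this costs at most a factor 2, by Bernoulli's inequality.
  have hQge : 2 * l * (1 - 3 / l ^ 2) ≤ Q := by
    have e1 : (n - T) * (2 * l / n) = 2 * l * (1 - l⁻¹ ^ 3) := by
      rw [hT]; field_simp
    have e2 : T * (2 * l / n) = 2 * l⁻¹ ^ 2 := by
      rw [hT]; field_simp
    have e3 : 3 / l ^ 2 = 3 * l⁻¹ ^ 2 := by field_simp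
    rw [hQ, e1, e2, e3, le_div_iff₀ (by positivity), mul_assoc]
    refine mul_le_mul_of_nonneg_left ?_ (by positivity)
    have h3 : l⁻¹ ^ 3 ≤ l⁻¹ ^ 2 := pow_le_pow_of_le_one hinv.le (by linarith) (by norm_num)
    nlinarith [pow_pos hinv 4]
  have h36 : 3 / l ^ 2 ≤ 1 / 2 := by
    rw [div_le_iff₀ (by positivity)]
    nlinarith
  have hQl : l ≤ Q := by nlinarith
  have hQL : n / (4 * l) ≤ Q ^ L := by
    have hb : 1 / 2 ≤ (1 - 3 / l ^ 2) ^ L := by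
      have hber := one_add_mul_le_pow (a := -(3 / l ^ 2)) (by linarith) L
      rw [← sub_eq_add_neg] at hber
      refine le_trans ?_ hber
      have : (L : ℝ) * (3 / l ^ 2) ≤ 1 / 2 := by
        calc (L : ℝ) * (3 / l ^ 2) ≤ l * (3 / l ^ 2) := by gcongr
          _ = 3 / l := by field_simp
          _ ≤ 1 / 2 := by rw [div_le_iff₀ hl0]; linarith
      linarith
    have hn2 : (n : ℝ) / (2 * l) ≤ (2 * l) ^ L := by
      rw [div_le_iff₀ (by positivity), ← pow_succ]
      exact hL2.le
    calc (n : ℝ) / (4 * l) = n / (2 * l) * (1 / 2) := by field_simp; norm_num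
      _ ≤ (2 * l) ^ L * (1 - 3 / l ^ 2) ^ L := by gcongr
      _ = (2 * l * (1 - 3 / l ^ 2)) ^ L := (mul_pow _ _ _).symm
      _ ≤ Q ^ L := by
        have : 0 ≤ 1 - 3 / l ^ 2 := by linarith
        gcongr
  have hQ0 : 0 < Q := by linarith
  have hrate : T / Q ^ L + 2 / Q ≤ 3 / l := by
    have h1 : T / Q ^ L ≤ 1 / l := by
      rw [div_le_iff₀ (by positivity)]
      refine le_trans ?_ (mul_le_mul_of_nonneg_left hQL (by positivity))
      rw [hT, div_mul_div_comm, one_mul, div_le_div_iff_of_pos_left hn0 (by positivity)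
        (by positivity)]
      nlinarith [pow_pos hl0 2]
    have h2 : 2 / Q ≤ 2 / l := by gcongr
    calc _ ≤ 1 / l + 2 / l := add_le_add h1 h2
      _ = 3 / l := by ring
  have hball : ∀ v : Fin n, graphProb (edgeProb n : unitInterval)
      (fun G => (closedBall G v L).card < T) ≤ Real.exp 1 * Real.exp (-(l / 3)) := by
    intro v
    have hp0 : (0 : ℝ) < (edgeProb n : unitInterval) := by rw [hp]; positivity
    refine (graphProb_closedBall_lt_le (Q := Q) hp0 (edgeProb n).2.2 hT0 (by simpa using hTn)
      (by rw [hp, Fintype.card_fin]; exact hQ) (by linarith) L v).trans ?_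
    have hpos : 0 < T / Q ^ L + 2 / Q := by positivity
    have : l / 3 ≤ 1 / (T / Q ^ L + 2 / Q) := by
      rw [le_div_iff₀ hpos]
      calc l / 3 * (T / Q ^ L + 2 / Q) ≤ l / 3 * (3 / l) :=
            mul_le_mul_of_nonneg_left hrate (by positivity)
        _ = 1 := by field_simp
    exact mul_le_mul_of_nonneg_left (Real.exp_le_exp.mpr (neg_le_neg this)) (Real.exp_pos 1).le
  have main := le_binomialRandom_le_total (edgeProb n) σ hm0 hmn hT0 hmT
    (by rw [hnp]; linarith) hball
  rw [hnp] at main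
  -- The exponent 8 in `m` pays here: `m / T ≤ l^(-5)` beats the factor `(L + 1)^2 ≤ 4 l^2`.
  have herr : 8 * ((L : ℝ) + 1) ^ 2 * m * ((2 * l) ^ L / n) / T ≤ 32 / l ^ 3 := by
    have h1 : (2 * l) ^ L / n ≤ 1 := by rwa [div_le_one hn0]
    have h2 : ((L : ℝ) + 1) ^ 2 ≤ (2 * l) ^ 2 := by gcongr; linarith
    calc 8 * ((L : ℝ) + 1) ^ 2 * m * ((2 * l) ^ L / n) / T
        ≤ 8 * (2 * l) ^ 2 * (T / l ^ 5) * 1 / T := by gcongr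
      _ = 32 / l ^ 3 := by field_simp; norm_num
  refine le_trans (by linarith) (main.trans ?_)
  refine MeasureTheory.measureReal_mono fun G hG pick hpick => le_trans ?_ (hG pick hpick)
  calc 1 / 8 * (n : ℝ) ^ 2 / l ^ 11 = n / l ^ 8 / 2 * T / 4 := by
        rw [hT]; field_simp; norm_num
    _ ≤ m * T / 4 := by gcongr

end RandomGraph

theorem mainTheorem7 :
    ∃ c : ℝ, 0 < c ∧ ∃ k : ℕ, ∀ order : (n : ℕ) → Equiv.Perm (Fin n),
      Tendsto
        (fun n : ℕ =>
          (SimpleGraph.binomialRandom (Fin n) (PrunedLabeling.edgeProb n)).real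
            {G : SimpleGraph (Fin n) |
              ∀ pick : PrunedLabeling.BFSState (Fin n) → Fin n,
                PrunedLabeling.IsExtractMin pick →
                c * (n : ℝ) ^ 2 / Real.log n ^ k ≤
                  ((PrunedLabeling.prunedLabeling pick (PrunedLabeling.toDigraph G)
                    (List.ofFn (order n))).total : ℝ)})
        atTop (𝓝 1) := by
  -- From `m * T / 4` with `m ≥ n / (2 l^8)` and `T = n / l^3`.
  refine ⟨1 / 8, by norm_num, 11, fun order => ?_⟩
  have hlog : Tendsto (fun n : ℕ => Real.log n) atTop atTop :=
    Real.tendsto_log_atTop.comp tendsto_natCast_atTop_atTop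
  have hpow : ∀ᶠ n : ℕ in atTop, Real.log n ^ 8 ≤ n := by
    have h := (Real.isLittleO_pow_log_id_atTop (n := 8)).bound one_pos
    filter_upwards [tendsto_natCast_atTop_atTop.eventually h] with n hn
    rw [one_mul, Real.norm_eq_abs, Real.norm_eq_abs] at hn
    simpa using (le_abs_self _).trans hn
  have hlim : Tendsto (fun n : ℕ => 1 - 2 * (Real.exp 1 * Real.exp (-(Real.log n / 3))) -
      32 / Real.log n ^ 3) atTop (𝓝 (1 - 2 * (Real.exp 1 * 0) - 0)) := by
    refine Tendsto.sub (tendsto_const_nhds.sub (Tendsto.const_mul _ (Tendsto.const_mul _ ?_))) ?_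
    · exact Real.tendsto_exp_neg_atTop_nhds_zero.comp (hlog.atTop_div_const (by norm_num))
    · exact Tendsto.const_div_atTop ((tendsto_pow_atTop (by norm_num)).comp hlog) 32
  rw [mul_zero, mul_zero, sub_zero, sub_zero] at hlim
  refine tendsto_of_tendsto_of_tendsto_of_le_of_le' hlim tendsto_const_nhds ?_ ?_
  · filter_upwards [hlog.eventually_ge_atTop 6, hpow] with n h6 h8
    exact RandomGraph.le_binomialRandom_le_total_of_log (order n) h6 h8
  · exact Eventually.of_forall fun n => MeasureTheory.measureReal_le_one
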